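/- Let $\Sigma=\mathbb N^{\infty}$ be the full one-sided shift over a countably infinite alphabet, with the product topology, and $\sigma:\Sigma\to\Sigma$ the shift map; for a finite word $w$ of length $n$ let $[w]\subset\Sigma$ be the set of sequences that begin with $w$. Fix $\beta>0$. For $\varphi:\Sigma\to\mathbb R$ and $n\ge1$ put $V_n(\varphi)=\sup\{|\varphi(x)-\varphi(y)|:x_1=y_1,\dots,x_n=y_n\}$ and call $\varphi$ Hölder continuous (of order $\beta$) if $\sup_{n\ge1}e^{\beta n}V_n(\varphi)<\infty$. Write $S_n\varphi=\sum_{j=0}^{n-1}\varphi\circ\sigma^j$, and let $$P(\varphi)=\lim_{n\to\infty}\frac1n\log\sum_{|w|=n}\ \sup_{\tau\in[w]}e^{S_n\varphi(\tau)},\qquad Z_n(\varphi,i)=\sum_{\sigma^n\omega=\omega,\ \omega_1=i}e^{S_n\varphi(\omega)} .$$ Call $\varphi$ positive recurrent with constant $\lambda>0$ if for every $i\in\mathbb N$ there are $M_i>0$ and $N_i$ with $M_i^{-1}\le\lambda^{-n}Z_n(\varphi,i)\le M_i$ for all $n\ge N_i$. Let $(X,d)$ be a non-empty compact metric space, let $\phi_i:X\to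 X$ ($i\in\mathbb N$) satisfy $d(\phi_i(x),\phi_i(y))\le s\,d(x,y)$ for all $i,x,y$ with one constant $s<1$, and let $\pi:\Sigma\to X$ be given by $\{\pi(\omega)\}=\bigcap_{n\ge1}\phi_{\omega_1}\circ\dots\circ\phi_{\omega_n}(X)$. Let $\phi^{(i)}:X\to\mathbb R$ ($i\in\mathbb N$) be continuous with $$\sup_{x\in X}\sum_{i\in\mathbb N}e^{\phi^{(i)}(x)}<\infty ,$$ and suppose that the function $\phi:\Sigma\to\mathbb R$, $\phi(\omega)=\phi^{(\omega_1)}(\pi(\sigma\omega))$, is Hölder continuous of order $\beta$. On the space $C_b(\Sigma)$ of bounded continuous real functions with the supremum norm $\|\cdot\|_0$, let $L_\phi g(\omega)=\sum_{\tau\in\sigma^{-1}(\omega)}e^{\phi(\tau)}g(\tau)$, and let $L_\phi^*$ be the operator conjugate to $L_\phi$, acting on the dual space of $C_b(\Sigma)$. **Theorem.** The limit $P(\phi)$ exists and is finite, and, with $\lambda=e^{P(\phi)}$: 1. $\phi$ is positive recurrent with constant $\lambda$. 2. There is $M>0$ such that $M^{-1}\le\lambda^{-n}L_\phi^n(1)\le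 M$ on $\Sigma$ for all $n\ge1$. 3. If in addition $\phi_i(X)\cap\phi_j(X)=\emptyset$ for all $i\ne j$, then there are a Borel probability measure $\nu$ on $\Sigma$ and a Hölder continuous (of order $\beta$) function $h:\Sigma\to(0,\infty)$, bounded away from $0$ and $\infty$, such that $L_\phi^*\nu=\lambda\nu$, $L_\phi h=\lambda h$ and $\int h\,d\nu=1$; moreover $\lambda^{-n}L_\phi^n g\to(\int g\,d\nu)\,h$ uniformly on $\Sigma$ for every bounded uniformly continuous $g:\Sigma\to\mathbb R$, and there is $\gamma\in(0,1)$ such that for every bounded Hölder continuous (of order $\beta$) $g:\Sigma\to\mathbb R$ there is a constant $C$ with $\|\lambda^{-n}L_\phi^n g-(\int g\,d\nu)\,h\|_0\le C\gamma^n$ for all $n\ge0$. -/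

import Mathlib

open MeasureTheory Set Filter Topology
open scoped ENNReal NNReal BoundedContinuousFunction

namespace CountableIFS

/-- The one-sided full shift space over a countably infinite alphabet (the alphabet is indexed by
`ℕ`, coordinates are numbered from `0`), with the product topology, product uniformity and product
(= Borel) sigma-algebra. -/
abbrev ShiftSpace : Type := ℕ → ℕ

/-- The shift transformation: cut out the first coordinate. -/
def shift (ω : ShiftSpace) : ShiftSpace := fun n => ω (n + 1)

/-- `prepend i ω` is the sequence `i ω₀ ω₁ …`. -/
def prepend (i : ℕ) (ω : ShiftSpace) : ShiftSpace
  | 0 => i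
  | n + 1 => ω n

/-- The sequences `prepend i ω`, `i ∈ ℕ`, are exactly the preimages of `ω` under the shift
(pairwise distinct, as they differ in the first coordinate). -/
theorem shift_eq_iff (τ ω : ShiftSpace) : shift τ = ω ↔ ∃ i, τ = prepend i ω := by
  constructor
  · rintro rfl
    refine ⟨τ 0, funext fun n => ?_⟩
    cases n <;> rfl
  · rintro ⟨i, rfl⟩
    rfl

/-- `V_n(φ) = sup {|φ(x) - φ(y)| : x and y agree in the first n coordinates}`. -/
noncomputable def variation (φ : ShiftSpace → ℝ) (n : ℕ) : ℝ≥0∞ :=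
  ⨆ (x : ShiftSpace) (y : ShiftSpace) (_ : ∀ k < n, x k = y k), ENNReal.ofReal |φ x - φ y|

/-- `V(φ) = sup_{n ≥ 1} e^{βn} V_n(φ)`. -/
noncomputable def holderConst (β : ℝ) (φ : ShiftSpace → ℝ) : ℝ≥0∞ :=
  ⨆ (n : ℕ) (_ : 1 ≤ n), ENNReal.ofReal (Real.exp (β * n)) * variation φ n

/-- Hölder continuity of order `β` (with no restriction on pairs of points that differ in the
first coordinate, so that unbounded functions are allowed). -/
def HolderOfOrder (β : ℝ) (φ : ShiftSpace → ℝ) : Prop := holderConst β φ < ∞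

theorem HolderOfOrder.bound {β : ℝ} {φ : ShiftSpace → ℝ} (h : HolderOfOrder β φ) :
    ∃ C : ℝ, 0 ≤ C ∧ ∀ n : ℕ, 1 ≤ n → ∀ x y : ShiftSpace, (∀ k < n, x k = y k) →
      |φ x - φ y| ≤ C * Real.exp (-(β * n)) := by
  refine ⟨(holderConst β φ).toReal, ENNReal.toReal_nonneg, fun n hn x y hxy => ?_⟩
  have h1 : ENNReal.ofReal |φ x - φ y| ≤ variation φ n :=
    le_iSup_of_le x (le_iSup_of_le y (le_iSup_of_le hxy le_rfl))
  have h2 : ENNReal.ofReal (Real.exp (β * n)) * variation φ n ≤ holderConst β φ :=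
    le_iSup_of_le n (le_iSup_of_le hn le_rfl)
  have h3 : ENNReal.ofReal (Real.exp (β * n) * |φ x - φ y|) ≤ holderConst β φ := by
    rw [ENNReal.ofReal_mul (Real.exp_pos _).le]
    exact (mul_le_mul_right h1 _).trans h2
  have h4 := (ENNReal.ofReal_le_iff_le_toReal h.ne).1 h3
  rw [Real.exp_neg, ← div_eq_mul_inv, le_div_iff₀ (Real.exp_pos _)]
  linarith

theorem HolderOfOrder.continuous {β : ℝ} (hβ : 0 < β) {φ : ShiftSpace → ℝ}
    (h : HolderOfOrder β φ) : Continuous φ := by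
  obtain ⟨C, hC, hb⟩ := h.bound
  rw [continuous_iff_continuousAt]
  intro x
  rw [ContinuousAt, Metric.tendsto_nhds]
  intro ε hε
  have ht : Tendsto (fun n : ℕ => C * Real.exp (-(β * n))) atTop (𝓝 (C * 0)) := by
    refine Tendsto.const_mul C (Real.tendsto_exp_neg_atTop_nhds_zero.comp ?_)
    exact tendsto_natCast_atTop_atTop.const_mul_atTop hβ
  rw [mul_zero] at ht
  obtain ⟨n, hn, hn1⟩ := ((ht.eventually_lt_const hε).and (eventually_ge_atTop 1)).exists
  have hev : ∀ᶠ y : ShiftSpace in 𝓝 x, ∀ k ∈ Finset.range n, y k = x k := by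
    rw [Filter.eventually_all_finset]
    intro k _
    exact (continuous_apply k).continuousAt.eventually ((isOpen_discrete {x k}).mem_nhds rfl)
  filter_upwards [hev] with y hy
  rw [Real.dist_eq]
  exact (hb n hn1 y x fun k hk => hy k (Finset.mem_range.2 hk)).trans_lt hn

/-- The condition `sup_ω ∑_{τ ∈ σ⁻¹(ω)} e^{φ(τ)} < ∞`, under which the transfer operator acts on
bounded continuous functions. -/
def FiniteTransfer (φ : ShiftSpace → ℝ) : Prop :=
  (⨆ ω : ShiftSpace, ∑' i : ℕ, ENNReal.ofReal (Real.exp (φ (prepend i ω)))) < ∞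

/-- Pointwise formula `(L_φ g)(ω) = ∑_{τ ∈ σ⁻¹(ω)} e^{φ(τ)} g(τ)`. -/
noncomputable def transferFun (φ g : ShiftSpace → ℝ) (ω : ShiftSpace) : ℝ :=
  ∑' i : ℕ, Real.exp (φ (prepend i ω)) * g (prepend i ω)

theorem continuous_prepend (i : ℕ) : Continuous (prepend i) := by
  refine continuous_pi fun n => ?_
  cases n with
  | zero => exact continuous_const
  | succ n => exact continuous_apply n

/-- The weights of the transfer operator are dominated by a summable sequence. -/
theorem exists_summable_bound {β : ℝ} {φ : ShiftSpace → ℝ} (hβ : 0 < β)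
    (hφ : HolderOfOrder β φ) (hs : FiniteTransfer φ) :
    ∃ b : ℕ → ℝ, Summable b ∧ ∀ i ω, Real.exp (φ (prepend i ω)) ≤ b i := by
  obtain ⟨C, hC, hb⟩ := hφ.bound
  have h0 : ∑' i : ℕ, ENNReal.ofReal (Real.exp (φ (prepend i fun _ => 0))) ≠ ∞ :=
    ((le_iSup (fun ω : ShiftSpace => ∑' i : ℕ, ENNReal.ofReal (Real.exp (φ (prepend i ω))))
      (fun _ => 0)).trans_lt hs).ne
  have h1 : Summable fun i : ℕ => Real.exp (φ (prepend i fun _ => 0)) := by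
    refine (ENNReal.summable_toReal h0).congr fun i => ?_
    exact ENNReal.toReal_ofReal (Real.exp_pos _).le
  refine ⟨_, h1.mul_left (Real.exp C), fun i ω => ?_⟩
  rw [← Real.exp_add, Real.exp_le_exp]
  have h2 := hb 1 le_rfl (prepend i ω) (prepend i fun _ => 0) (by
    intro k hk
    obtain rfl : k = 0 := by omega
    rfl)
  have h3 : Real.exp (-(β * (1 : ℕ))) ≤ 1 := Real.exp_le_one_iff.2 (by simp; exact hβ.le)
  have h4 := le_abs_self (φ (prepend i ω) - φ (prepend i fun _ => 0))
  have h5 := mul_le_mul_of_nonneg_left h3 hC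
  linarith

/-- The Perron-Frobenius-Ruelle operator `L_φ` as a bounded linear operator on the Banach space of
bounded continuous real functions on the shift space (with the supremum norm). -/
noncomputable def transferOp {β : ℝ} {φ : ShiftSpace → ℝ} (hβ : 0 < β)
    (hφ : HolderOfOrder β φ) (hs : FiniteTransfer φ) :
    (ShiftSpace →ᵇ ℝ) →L[ℝ] (ShiftSpace →ᵇ ℝ) :=
  have hdom : ∀ b : ℕ → ℝ, (∀ i ω, Real.exp (φ (prepend i ω)) ≤ b i) →
      ∀ (g : ShiftSpace →ᵇ ℝ) (i : ℕ) (ω : ShiftSpace),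
      ‖Real.exp (φ (prepend i ω)) * g (prepend i ω)‖ ≤ b i * ‖g‖ := by
    intro b hle g i ω
    rw [norm_mul, Real.norm_of_nonneg (Real.exp_pos _).le]
    exact mul_le_mul (hle i ω) (g.norm_coe_le_norm _) (norm_nonneg _)
      ((Real.exp_pos _).le.trans (hle i ω))
  have hsm : ∀ (g : ShiftSpace →ᵇ ℝ) (ω : ShiftSpace),
      Summable fun i => Real.exp (φ (prepend i ω)) * g (prepend i ω) := by
    obtain ⟨b, hb, hle⟩ := exists_summable_bound hβ hφ hs
    exact fun g ω => Summable.of_norm_bounded (hb.mul_right ‖g‖) fun i => hdom b hle g i ω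
  have hcont : ∀ g : ShiftSpace →ᵇ ℝ, Continuous (transferFun φ g) := by
    obtain ⟨b, hb, hle⟩ := exists_summable_bound hβ hφ hs
    intro g
    refine continuous_tsum (fun i => ?_) (hb.mul_right ‖g‖) fun i ω => hdom b hle g i ω
    exact (Real.continuous_exp.comp ((hφ.continuous hβ).comp (continuous_prepend i))).mul
      (g.continuous.comp (continuous_prepend i))
  have hbd : ∃ K : ℝ, ∀ (g : ShiftSpace →ᵇ ℝ) (ω : ShiftSpace),
      ‖transferFun φ g ω‖ ≤ K * ‖g‖ := by
    obtain ⟨b, hb, hle⟩ := exists_summable_bound hβ hφ hs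
    exact ⟨∑' i, b i, fun g ω =>
      tsum_of_norm_bounded (hb.hasSum.mul_right ‖g‖) fun i => hdom b hle g i ω⟩
  LinearMap.mkContinuousOfExistsBound
    { toFun := fun g => BoundedContinuousFunction.ofNormedAddCommGroup (transferFun φ g) (hcont g)
        (hbd.choose * ‖g‖) (hbd.choose_spec g)
      map_add' := by
        intro f g
        ext ω
        simp only [BoundedContinuousFunction.coe_ofNormedAddCommGroup,
          BoundedContinuousFunction.coe_add, Pi.add_apply, transferFun, mul_add]
        exact (hsm f ω).tsum_add (hsm g ω)
      map_smul' := by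
        intro c g
        ext ω
        simp only [BoundedContinuousFunction.coe_ofNormedAddCommGroup,
          BoundedContinuousFunction.coe_smul, smul_eq_mul, transferFun, RingHom.id_apply,
          ← tsum_mul_left]
        exact tsum_congr fun i => by ring }
    (by
      refine ⟨max hbd.choose 0, fun g => ?_⟩
      refine (BoundedContinuousFunction.norm_le (by positivity)).2 fun ω => ?_
      exact (hbd.choose_spec g ω).trans
        (mul_le_mul_of_nonneg_right (le_max_left _ _) (norm_nonneg _)))

/-- The operator `transferOp` is given by the usual formula. -/
theorem transferOp_apply {β : ℝ} {φ : ShiftSpace → ℝ} (hβ : 0 < β) (hφ : HolderOfOrder β φ)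
    (hs : FiniteTransfer φ) (g : ShiftSpace →ᵇ ℝ) (ω : ShiftSpace) :
    transferOp hβ hφ hs g ω = ∑' i : ℕ, Real.exp (φ (prepend i ω)) * g (prepend i ω) := rfl

/-- The operator conjugate to `L`, acting on the dual space of the bounded continuous functions. -/
noncomputable def conjugateOp (L : (ShiftSpace →ᵇ ℝ) →L[ℝ] (ShiftSpace →ᵇ ℝ)) :
    StrongDual ℝ (ShiftSpace →ᵇ ℝ) →L[ℝ] StrongDual ℝ (ShiftSpace →ᵇ ℝ) :=
  L.precomp ℝ

/-- A Borel probability measure `ν` as the functional `g ↦ ∫ g dν`. -/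
noncomputable def integralFunctional (ν : ProbabilityMeasure ShiftSpace) :
    StrongDual ℝ (ShiftSpace →ᵇ ℝ) :=
  LinearMap.mkContinuous
    { toFun := fun g => ∫ ω, g ω ∂(ν : Measure ShiftSpace)
      map_add' := fun f g => integral_add (f.integrable _) (g.integrable _)
      map_smul' := fun c g => integral_const_mul c _ } 1
    (fun g => by
      have := g.norm_integral_le_norm (μ := (ν : Measure ShiftSpace))
      simpa using this)

/-- The cylinder `[w]` of a finite word `w`. -/
def cylinder {n : ℕ} (w : Fin n → ℕ) : Set ShiftSpace := {τ | ∀ k : Fin n, τ k = w k}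

/-- `Z_n(φ) = ∑_{|w| = n} sup_{τ ∈ [w]} exp (∑_{j<n} φ(σ^j τ))`. -/
noncomputable def partitionFn (φ : ShiftSpace → ℝ) (n : ℕ) : ℝ≥0∞ :=
  ∑' w : Fin n → ℕ, ⨆ τ ∈ cylinder w, ENNReal.ofReal (Real.exp (birkhoffSum shift φ n τ))

/-- The topological pressure of `φ` exists and is the real number `P`:
`P = lim_{n → ∞} (1/n) log Z_n(φ)`, a limit of extended reals. -/
def HasPressure (φ : ShiftSpace → ℝ) (P : ℝ) : Prop :=
  Tendsto (fun n : ℕ => ENNReal.log (partitionFn φ n) / (n : EReal)) atTop (𝓝 (P : EReal))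

/-- `Z_n(φ, i)`: the sum of `exp (∑_{j<n} φ(σ^j ω))` over all `ω` with `σ^n ω = ω` and first
coordinate `i`. -/
noncomputable def periodicPartitionFn (φ : ShiftSpace → ℝ) (n i : ℕ) : ℝ≥0∞ :=
  ∑' ω : {ω : ShiftSpace // shift^[n] ω = ω ∧ ω 0 = i},
    ENNReal.ofReal (Real.exp (birkhoffSum shift φ n ω))

/-- Positive recurrence of `φ` with the growth constant `lam`. -/
def PositiveRecurrentWith (φ : ShiftSpace → ℝ) (lam : ℝ) : Prop :=
  0 < lam ∧ ∀ i : ℕ, ∃ M : ℝ, 0 < M ∧ ∃ N : ℕ, ∀ n : ℕ, N ≤ n →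
    ENNReal.ofReal M⁻¹ ≤ periodicPartitionFn φ n i / ENNReal.ofReal (lam ^ n) ∧
    periodicPartitionFn φ n i / ENNReal.ofReal (lam ^ n) ≤ ENNReal.ofReal M

/-- A countable family of uniform contractions of a metric space. -/
structure UniformIFS (X : Type*) [MetricSpace X] where
  map : ℕ → X → X
  ratio : ℝ≥0
  ratio_lt_one : ratio < 1
  contract : ∀ (i : ℕ) (x y : X), dist (map i x) (map i y) ≤ ratio * dist x y

namespace UniformIFS

variable {X : Type*} [MetricSpace X]

/-- `φ_{ω|n} = φ_{ω₀} ∘ ⋯ ∘ φ_{ω_{n-1}}`. -/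
def wordMap (F : UniformIFS X) (ω : ShiftSpace) : ℕ → X → X
  | 0 => id
  | n + 1 => wordMap F ω n ∘ F.map (ω n)

theorem dist_wordMap_le (F : UniformIFS X) (ω : ShiftSpace) (n : ℕ) :
    ∀ x y : X, dist (F.wordMap ω n x) (F.wordMap ω n y) ≤ (F.ratio : ℝ) ^ n * dist x y := by
  induction n with
  | zero => intro x y; simp [wordMap]
  | succ n ih =>
    intro x y
    refine (ih _ _).trans ?_
    rw [pow_succ, mul_assoc]
    exact mul_le_mul_of_nonneg_left (F.contract _ x y) (by positivity)

theorem existsUnique_coding [CompactSpace X] [Nonempty X] (F : UniformIFS X) (ω : ShiftSpace) :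
    ∃! x : X, x ∈ ⋂ (n : ℕ) (_ : 1 ≤ n), range (F.wordMap ω n) := by
  have hc : ∀ n, Continuous (F.wordMap ω n) := fun n =>
    (LipschitzWith.of_dist_le_mul (K := F.ratio ^ n) (by
      simpa using F.dist_wordMap_le ω n)).continuous
  have hk : ∀ n, IsCompact (range (F.wordMap ω n)) := fun n => isCompact_range (hc n)
  obtain ⟨x, hx⟩ := IsCompact.nonempty_iInter_of_sequence_nonempty_isCompact_isClosed
    (fun n => range (F.wordMap ω n))
    (fun n => by rintro _ ⟨y, rfl⟩; exact ⟨F.map (ω n) y, rfl⟩)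
    (fun n => range_nonempty _) (hk 0) (fun n => (hk n).isClosed)
  rw [mem_iInter] at hx
  refine ⟨x, by simp only [mem_iInter]; exact fun n _ => hx n, fun y hy => ?_⟩
  simp only [mem_iInter] at hy
  have hD : ∀ n : ℕ, 1 ≤ n → dist y x ≤ (F.ratio : ℝ) ^ n * Metric.diam (univ : Set X) := by
    intro n hn
    obtain ⟨a, rfl⟩ := hy n hn
    obtain ⟨b, hb⟩ := hx n
    rw [← hb]
    refine (F.dist_wordMap_le ω n a b).trans (mul_le_mul_of_nonneg_left ?_ (by positivity))
    exact Metric.dist_le_diam_of_mem isCompact_univ.isBounded (mem_univ _) (mem_univ _)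
  have ht : Tendsto (fun n : ℕ => (F.ratio : ℝ) ^ n * Metric.diam (univ : Set X)) atTop
      (𝓝 (0 * Metric.diam (univ : Set X))) :=
    (tendsto_pow_atTop_nhds_zero_of_lt_one F.ratio.coe_nonneg F.ratio_lt_one).mul_const _
  rw [zero_mul] at ht
  refine dist_le_zero.1 (ge_of_tendsto ht ?_)
  filter_upwards [eventually_ge_atTop 1] with n hn using hD n hn

/-- The projection `π`: `π(ω)` is the only point of `⋂_{n ≥ 1} φ_{ω|n}(X)`. -/
noncomputable def coding [CompactSpace X] [Nonempty X] (F : UniformIFS X) (ω : ShiftSpace) : X :=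
  (F.existsUnique_coding ω).choose

/-- The potential `φ(ω) = ψ_{ω₀}(π(σ ω))` induced by a family of functions `ψ_i` on `X`. -/
noncomputable def potential [CompactSpace X] [Nonempty X] (F : UniformIFS X) (ψ : ℕ → C(X, ℝ))
    (ω : ShiftSpace) : ℝ :=
  ψ (ω 0) (F.coding (shift ω))

theorem finiteTransfer_potential [CompactSpace X] [Nonempty X] (F : UniformIFS X)
    (ψ : ℕ → C(X, ℝ)) (h : (⨆ x : X, ∑' i : ℕ, ENNReal.ofReal (Real.exp (ψ i x))) < ∞) :
    FiniteTransfer (F.potential ψ) :=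
  (iSup_le fun ω => le_iSup (fun x : X => ∑' i : ℕ, ENNReal.ofReal (Real.exp (ψ i x)))
    (F.coding ω)).trans_lt h

end UniformIFS

end CountableIFS

open CountableIFS

/-! The proof is a coupling argument on the shift. Write θ = e^{-β}. The Hölder hypothesis and the
summability hypothesis give variations at most C θ^n and weights e^{φ(iω)} bounded by a summable
sequence `b i`. Bounded distortion (`pow_one_le`) says that L^n 1 changes by a factor of at most
exp(K θ^m) between points that agree in m coordinates, with K independent of n.

The core is a contraction of f_k = L^k g / L^k 1. Each f_{k+1}(x) is an average of the values
f_k(ix) with weights p_i(x), and distortion gives p_i(x) ≥ exp(-2K θ^n) p_i(y) if x and y agree in n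
coordinates. A common letter can therefore be drawn for x and y with probability exp(-2K θ^n), and
then ix and iy agree in n + 1 coordinates; otherwise the total oscillation of f_k is the bound. The
modulus D (1 - exp(-B θ^n)) is shaped so that this trade reproduces it with D replaced by κD, where
κ < 1 (`hasModulus_succ`). Later f_k are averages of earlier ones, so they converge uniformly and
geometrically to a constant.

That constant is an integral. The functionals g ↦ L^k g(0) / L^k 1(0) are atomic probability
measures, tight because `b` is summable, and Prokhorov's theorem yields a limit ν. Passing to the
limit in L^{k+1} g / L^k 1 gives L*ν = λν with λ = ∫ L1 dν, first for g with a modulus and then for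
all g by truncation (`exists_eigenmeasure`).

Since λ^n is the ν-average of L^n 1, distortion keeps λ^{-n} L^n 1 between e^{-K} and e^K. These
functions converge geometrically to h, and λ^{-n} L^n g is their product with f_n. The partition
functions, including the periodic ones, are sums over words comparable to L^n 1, so P = log λ and
positive recurrence follows. -/

namespace CountableIFS

/-! ### Coupling and contraction of the normalized iterates. -/

/-- `x` and `y` agree in the first `n` coordinates. -/
def AgreeUpTo (n : ℕ) (x y : ShiftSpace) : Prop := ∀ k < n, x k = y k

theorem AgreeUpTo.symm {n : ℕ} {x y : ShiftSpace} (h : AgreeUpTo n x y) : AgreeUpTo n y x :=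
  fun k hk => (h k hk).symm

theorem agreeUpTo_zero (x y : ShiftSpace) : AgreeUpTo 0 x y := fun _ hk => absurd hk (by simp)

theorem AgreeUpTo.prepend {n : ℕ} {x y : ShiftSpace} (h : AgreeUpTo n x y) (i : ℕ) :
    AgreeUpTo (n + 1) (prepend i x) (prepend i y) := by
  intro k hk
  cases k with
  | zero => rfl
  | succ k => exact h k (by omega)

/-- `L` is the transfer operator of a potential `φ` whose variations decay like `C θ ^ n` and whose
weights are dominated by the summable sequence `b`. -/
structure IsTransferOp (φ : ShiftSpace → ℝ) (θ C : ℝ) (b : ℕ → ℝ)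
    (L : (ShiftSpace →ᵇ ℝ) →L[ℝ] (ShiftSpace →ᵇ ℝ)) : Prop where
  hasSum : ∀ g ω, HasSum (fun i => Real.exp (φ (prepend i ω)) * g (prepend i ω)) (L g ω)
  theta_pos : 0 < θ
  theta_lt_one : θ < 1
  const_pos : 0 < C
  variation_le : ∀ n x y, AgreeUpTo (n + 1) x y → φ x - φ y ≤ C * θ ^ (n + 1)
  summable : Summable b
  weight_le : ∀ i ω, Real.exp (φ (prepend i ω)) ≤ b i

/-- The distortion constant of the iterates of a transfer operator. -/
noncomputable def distortion (θ C : ℝ) : ℝ := C * θ / (1 - θ)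

/-- The constant in the modulus of continuity that the normalized transfer operators contract. -/
noncomputable def modulusConst (θ C : ℝ) : ℝ := 4 * distortion θ C / (1 - θ)

/-- The contraction rate of the normalized transfer operators. -/
noncomputable def contractionRate (θ C : ℝ) : ℝ :=
  1 - Real.exp (-modulusConst θ C) * ((1 - θ) / 2)

/-- `f` has modulus of continuity `D (1 - exp (-B θ ^ n))` at points that agree in the first `n`
coordinates. -/
def HasModulus (θ B D : ℝ) (f : ShiftSpace → ℝ) : Prop :=
  ∀ n x y, AgreeUpTo n x y → f x - f y ≤ D * (1 - Real.exp (-(B * θ ^ n)))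

/-- A coupling estimate for two probability vectors `p`, `q` with `e q ≤ p`. -/
theorem coupling_estimate {p q f g : ℕ → ℝ} {e O δ A B : ℝ} (hp : HasSum p 1) (hq : HasSum q 1)
    (hq0 : ∀ i, 0 ≤ q i) (he : 0 ≤ e) (hpq : ∀ i, e * q i ≤ p i)
    (hA : HasSum (fun i => p i * f i) A) (hB : HasSum (fun i => q i * g i) B)
    (hO : ∀ i j, f i - g j ≤ O) (hδ : ∀ i, f i - g i ≤ δ) :
    A - B ≤ (1 - e) * O + e * δ := by
  have he1 : e ≤ 1 := by
    have := hasSum_le hpq (hq.mul_left e) hp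
    linarith
  have hbdd : BddAbove (range f) := ⟨g 0 + O, by rintro _ ⟨i, rfl⟩; linarith [hO i 0]⟩
  set S := ⨆ i, f i with hS
  have hf : ∀ i, f i ≤ S := fun i => le_ciSup hbdd i
  have hg : ∀ j, S - O ≤ g j := fun j => by
    have : S ≤ g j + O := ciSup_le fun i => by linarith [hO i j]
    linarith
  -- Split p into e q and the excess p - e q, and q into e q and (1 - e) q. The shared part e q
  -- costs δ; on the remainders, each of mass 1 - e, the bounds f ≤ S and g ≥ S - O cost O.
  have key : ∀ i, p i * f i - q i * g i ≤
      (p i - e * q i) * S + (e * q i) * δ - ((1 - e) * q i) * (S - O) := by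
    intro i
    have h1 := mul_le_mul_of_nonneg_left (hf i) (sub_nonneg.2 (hpq i))
    have h2 := mul_le_mul_of_nonneg_left (hδ i) (mul_nonneg he (hq0 i))
    have h3 := mul_le_mul_of_nonneg_left (hg i) (mul_nonneg (sub_nonneg.2 he1) (hq0 i))
    nlinarith
  have hR : HasSum (fun i => (p i - e * q i) * S + (e * q i) * δ - ((1 - e) * q i) * (S - O))
      ((1 - e * 1) * S + (e * 1) * δ - ((1 - e) * 1) * (S - O)) :=
    (((hp.sub (hq.mul_left e)).mul_right S).add ((hq.mul_left e).mul_right δ)).sub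
      ((hq.mul_left (1 - e)).mul_right (S - O))
  have := hasSum_le key (hA.sub hB) hR
  linarith

/-- The elementary inequality behind the contraction. -/
theorem one_sub_exp_mul_le {c B x : ℝ} (hc : c ≤ 1) (hx0 : 0 ≤ x) (hxB : x ≤ B) :
    1 - Real.exp (-(c * x)) ≤ (1 - Real.exp (-B) * (1 - c)) * (1 - Real.exp (-x)) := by
  -- The gain e^{-cx} - e^{-x} is at least e^{-x} (1 - c) x, which dominates e^{-B} (1 - c) (1 -
  -- e^{-x}) on [0, B].
  have h1 : Real.exp (-(c * x)) = Real.exp (-x) * Real.exp ((1 - c) * x) := by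
    rw [← Real.exp_add]; ring_nf
  have h2 := Real.add_one_le_exp ((1 - c) * x)
  have h3 : Real.exp (-B) ≤ Real.exp (-x) := Real.exp_le_exp.2 (by linarith)
  have h4 : 1 - Real.exp (-x) ≤ x := by linarith [Real.add_one_le_exp (-x)]
  have h5 := Real.exp_pos (-B)
  have h6 : Real.exp (-x) * ((1 - c) * x) ≤ Real.exp (-(c * x)) - Real.exp (-x) := by
    rw [h1]; nlinarith [Real.exp_pos (-x)]
  have h7 : Real.exp (-B) * (1 - c) * (1 - Real.exp (-x)) ≤ Real.exp (-x) * ((1 - c) * x) := by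
    calc Real.exp (-B) * (1 - c) * (1 - Real.exp (-x))
        ≤ Real.exp (-B) * (1 - c) * x :=
          mul_le_mul_of_nonneg_left h4 (mul_nonneg h5.le (by linarith))
      _ = Real.exp (-B) * ((1 - c) * x) := by ring
      _ ≤ Real.exp (-x) * ((1 - c) * x) :=
          mul_le_mul_of_nonneg_right h3 (mul_nonneg (by linarith) hx0)
  linarith

/-- A lower bound for the modulus of continuity. -/
theorem le_one_sub_exp_neg {B t : ℝ} (hB : 0 ≤ B) (ht0 : 0 ≤ t) (ht : t ≤ 1) :
    Real.exp (-B) * B * t ≤ 1 - Real.exp (-(B * t)) := by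
  have h1 := Real.add_one_le_exp (B * t)
  have h2 : Real.exp (-B) ≤ Real.exp (-(B * t)) := Real.exp_le_exp.2 (by nlinarith)
  have h3 : Real.exp (-(B * t)) * Real.exp (B * t) = 1 := by rw [← Real.exp_add]; simp
  have h4 : 0 ≤ B * t := by positivity
  nlinarith [Real.exp_pos (-(B * t))]

namespace IsTransferOp

variable {φ : ShiftSpace → ℝ} {θ C : ℝ} {b : ℕ → ℝ}
  {L : (ShiftSpace →ᵇ ℝ) →L[ℝ] (ShiftSpace →ᵇ ℝ)}

theorem distortion_pos (T : IsTransferOp φ θ C b L) : 0 < distortion θ C :=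
  div_pos (mul_pos T.const_pos T.theta_pos) (sub_pos.2 T.theta_lt_one)

theorem distortion_mul (T : IsTransferOp φ θ C b L) :
    distortion θ C * (1 - θ) = C * θ :=
  div_mul_cancel₀ _ (sub_pos.2 T.theta_lt_one).ne'

theorem modulusConst_pos (T : IsTransferOp φ θ C b L) : 0 < modulusConst θ C :=
  div_pos (mul_pos (by norm_num) T.distortion_pos) (sub_pos.2 T.theta_lt_one)

theorem modulusConst_mul (T : IsTransferOp φ θ C b L) :
    modulusConst θ C * (1 - θ) = 4 * distortion θ C :=
  div_mul_cancel₀ _ (sub_pos.2 T.theta_lt_one).ne'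

theorem contractionRate_lt_one (T : IsTransferOp φ θ C b L) : contractionRate θ C < 1 := by
  have := T.theta_lt_one
  have : 0 < Real.exp (-modulusConst θ C) * ((1 - θ) / 2) :=
    mul_pos (Real.exp_pos _) (by linarith)
  unfold contractionRate
  linarith

theorem contractionRate_pos (T : IsTransferOp φ θ C b L) : 0 < contractionRate θ C := by
  have h1 := T.theta_lt_one
  have h2 := T.theta_pos
  have h3 : Real.exp (-modulusConst θ C) ≤ 1 :=
    Real.exp_le_one_iff.2 (by linarith [T.modulusConst_pos])
  have h4 := Real.exp_pos (-modulusConst θ C)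
  unfold contractionRate
  nlinarith

theorem mono (T : IsTransferOp φ θ C b L) {f g : ShiftSpace →ᵇ ℝ} (h : ∀ ω, f ω ≤ g ω) (ω) :
    L f ω ≤ L g ω :=
  hasSum_le (fun _ => mul_le_mul_of_nonneg_left (h _) (Real.exp_pos _).le) (T.hasSum f ω)
    (T.hasSum g ω)

theorem pow_mono (T : IsTransferOp φ θ C b L) {f g : ShiftSpace →ᵇ ℝ} (h : ∀ ω, f ω ≤ g ω)
    (n : ℕ) : ∀ ω, (L ^ n) f ω ≤ (L ^ n) g ω := by
  induction n with
  | zero => exact h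
  | succ n ih =>
    intro ω
    rw [pow_succ', mul_apply_eq_comp, mul_apply_eq_comp]
    exact T.mono ih ω

theorem pow_one_pos (T : IsTransferOp φ θ C b L) (n : ℕ) : ∀ ω, 0 < (L ^ n) 1 ω := by
  induction n with
  | zero => exact fun ω => one_pos
  | succ n ih =>
    intro ω
    rw [pow_succ', mul_apply_eq_comp]
    exact (mul_pos (Real.exp_pos _) (ih _)).trans_le
      (le_hasSum (T.hasSum _ ω) 0 fun _ _ => (mul_pos (Real.exp_pos _) (ih _)).le)

/-- Bounded distortion, uniform in n. Prepending a letter lengthens the agreement by one, and K is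
the fixed point of K = Cθ + Kθ, so one more application of L leaves the constant unchanged. -/
theorem pow_one_le (T : IsTransferOp φ θ C b L) (n : ℕ) : ∀ (m : ℕ) (x y : ShiftSpace),
    AgreeUpTo m x y → (L ^ n) 1 x ≤ Real.exp (distortion θ C * θ ^ m) * (L ^ n) 1 y := by
  induction n with
  | zero =>
    intro m x y _
    have := T.distortion_pos
    have := T.theta_pos
    change 1 ≤ Real.exp (distortion θ C * θ ^ m) * 1
    rw [mul_one]
    exact Real.one_le_exp (by positivity)
  | succ n ih =>
    intro m x y hxy
    rw [pow_succ', mul_apply_eq_comp]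
    refine hasSum_le (fun i => ?_) (T.hasSum _ x) ((T.hasSum _ y).mul_left _)
    have h1 := T.variation_le m _ _ (hxy.prepend i)
    have h2 := ih _ _ _ (hxy.prepend i)
    have h3 : Real.exp (φ (prepend i x)) ≤
        Real.exp (C * θ ^ (m + 1)) * Real.exp (φ (prepend i y)) := by
      rw [← Real.exp_add]; exact Real.exp_le_exp.2 (by linarith)
    have h4 : Real.exp (distortion θ C * θ ^ m) =
        Real.exp (C * θ ^ (m + 1)) * Real.exp (distortion θ C * θ ^ (m + 1)) := by
      rw [← Real.exp_add]
      congr 1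
      have := T.distortion_mul
      rw [pow_succ]
      linear_combination (θ ^ m) * this
    calc _ ≤ _ := mul_le_mul h3 h2 (T.pow_one_pos n _).le (by positivity)
      _ = _ := by rw [h4]; ring

theorem pow_one_le_const (T : IsTransferOp φ θ C b L) (n : ℕ) (x y : ShiftSpace) :
    (L ^ n) 1 x ≤ Real.exp (distortion θ C) * (L ^ n) 1 y := by
  simpa using T.pow_one_le n 0 x y (agreeUpTo_zero x y)

/-- One step of the contraction of the normalized iterates `L ^ n g / L ^ n 1`. -/
theorem hasModulus_succ (T : IsTransferOp φ θ C b L) {D : ℝ} (hD : 0 ≤ D) (g : ShiftSpace →ᵇ ℝ)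
    (k : ℕ) (h : HasModulus θ (modulusConst θ C) D fun x => (L ^ k) g x / (L ^ k) 1 x) :
    HasModulus θ (modulusConst θ C) (contractionRate θ C * D)
      fun x => (L ^ (k + 1)) g x / (L ^ (k + 1)) 1 x := by
  intro n x y hxy
  have hθ0 := T.theta_pos
  have hθ1 := T.theta_lt_one
  have hK := T.distortion_pos
  have hBm := T.modulusConst_pos
  set B := modulusConst θ C with hB
  set K := distortion θ C with hKdef
  set l : ShiftSpace → ℝ := ⇑((L ^ k) 1) with hl
  set l' : ShiftSpace → ℝ := ⇑((L ^ (k + 1)) 1) with hl'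
  have hlpos : ∀ z, 0 < l z := T.pow_one_pos k
  have hlpos' : ∀ z, 0 < l' z := T.pow_one_pos (k + 1)
  have hprob : ∀ z, HasSum (fun i => Real.exp (φ (prepend i z)) * l (prepend i z) / l' z) 1 := by
    intro z
    have := (T.hasSum ((L ^ k) 1) z).div_const (l' z)
    rwa [← mul_apply_eq_comp, ← pow_succ', div_self (hlpos' z).ne'] at this
  have hval : ∀ z, HasSum (fun i => Real.exp (φ (prepend i z)) * l (prepend i z) / l' z *
      ((L ^ k) g (prepend i z) / l (prepend i z))) ((L ^ (k + 1)) g z / l' z) := by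
    intro z
    have := (T.hasSum ((L ^ k) g) z).div_const (l' z)
    rw [← mul_apply_eq_comp, ← pow_succ'] at this
    refine this.congr_fun ?_
    intro i
    have := (hlpos (prepend i z)).ne'
    field_simp
  -- Three distortions add up: that of the weight, of L^k 1 at the preimages, and of the normalizing
  -- denominator. As Cθ + Kθ = K, their sum is exactly 2K θ^n.
  have hcomp : ∀ i, Real.exp (-(2 * K * θ ^ n)) *
      (Real.exp (φ (prepend i y)) * l (prepend i y) / l' y) ≤
      Real.exp (φ (prepend i x)) * l (prepend i x) / l' x := by
    intro i
    have h1 := T.variation_le n _ _ (hxy.prepend i).symm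
    have h2 := T.pow_one_le k (n + 1) _ _ (hxy.prepend i).symm
    have h3 := T.pow_one_le (k + 1) n _ _ hxy
    rw [← mul_div_assoc, div_le_div_iff₀ (hlpos' y) (hlpos' x)]
    have h4 : Real.exp (φ (prepend i y)) ≤
        Real.exp (C * θ ^ (n + 1)) * Real.exp (φ (prepend i x)) := by
      rw [← Real.exp_add]; exact Real.exp_le_exp.2 (by linarith)
    have h5 : Real.exp (-(2 * K * θ ^ n)) * (Real.exp (C * θ ^ (n + 1)) *
        (Real.exp (K * θ ^ (n + 1)) * Real.exp (K * θ ^ n))) = 1 := by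
      rw [← Real.exp_add, ← Real.exp_add, ← Real.exp_add, Real.exp_eq_one_iff]
      have := T.distortion_mul
      rw [pow_succ]
      linear_combination (-(θ ^ n)) * this
    have h6 : Real.exp (φ (prepend i y)) * l (prepend i y) * l' x ≤
        (Real.exp (C * θ ^ (n + 1)) * Real.exp (φ (prepend i x))) *
        (Real.exp (K * θ ^ (n + 1)) * l (prepend i x)) * (Real.exp (K * θ ^ n) * l' y) := by
      have := (hlpos (prepend i y)).le
      have := (hlpos (prepend i x)).le
      have := (hlpos' x).le
      gcongr
    calc _ = Real.exp (-(2 * K * θ ^ n)) *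
          (Real.exp (φ (prepend i y)) * l (prepend i y) * l' x) := by ring
      _ ≤ _ := mul_le_mul_of_nonneg_left h6 (Real.exp_pos _).le
      _ = (Real.exp (-(2 * K * θ ^ n)) * (Real.exp (C * θ ^ (n + 1)) *
        (Real.exp (K * θ ^ (n + 1)) * Real.exp (K * θ ^ n)))) *
          (Real.exp (φ (prepend i x)) * l (prepend i x) * l' y) := by ring
      _ = _ := by rw [h5, one_mul]
  -- For different letters only the modulus at agreement length 0 is available, and it is at most D.
  have hO : ∀ i j, (L ^ k) g (prepend i x) / l (prepend i x) -
      (L ^ k) g (prepend j y) / l (prepend j y) ≤ D := by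
    intro i j
    refine (h 0 _ _ (agreeUpTo_zero _ _)).trans ?_
    exact mul_le_of_le_one_right hD (by linarith [Real.exp_pos (-(B * θ ^ 0))])
  have hδ : ∀ i, (L ^ k) g (prepend i x) / l (prepend i x) -
      (L ^ k) g (prepend i y) / l (prepend i y) ≤ D * (1 - Real.exp (-(B * θ ^ (n + 1)))) :=
    fun i => h (n + 1) _ _ (hxy.prepend i)
  have hmain := coupling_estimate (hprob x) (hprob y)
    (fun i => (div_pos (mul_pos (Real.exp_pos _) (hlpos _)) (hlpos' y)).le) (Real.exp_pos _).le
    hcomp (hval x) (hval y) hO hδ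
  have hθn : 0 ≤ θ ^ n := by positivity
  have hθn1 : θ ^ n ≤ 1 := pow_le_one₀ hθ0.le hθ1.le
  have hfin := one_sub_exp_mul_le (c := (1 + θ) / 2) (B := B) (x := B * θ ^ n) (by linarith)
    (by positivity) (by nlinarith)
  -- B was chosen with B(1 - θ) = 4K, so 2K + Bθ = B(1 + θ)/2: the loss from coupling uses only half
  -- of the gain from the extra agreeing letter.
  have hexp : Real.exp (-((1 + θ) / 2 * (B * θ ^ n))) =
      Real.exp (-(2 * K * θ ^ n)) * Real.exp (-(B * θ ^ (n + 1))) := by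
    rw [← Real.exp_add]
    congr 1
    have := T.modulusConst_mul
    rw [pow_succ]
    linear_combination (-(θ ^ n) / 2) * this
  refine hmain.trans ?_
  calc _ = D * (1 - Real.exp (-((1 + θ) / 2 * (B * θ ^ n)))) := by rw [hexp]; ring
    _ ≤ D * _ := mul_le_mul_of_nonneg_left hfin hD
    _ = _ := by
      have : 1 - (1 + θ) / 2 = (1 - θ) / 2 := by ring
      rw [this, contractionRate]; ring

theorem hasModulus_pow (T : IsTransferOp φ θ C b L) {D : ℝ} (hD : 0 ≤ D) (g : ShiftSpace →ᵇ ℝ)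
    (h : HasModulus θ (modulusConst θ C) D g) (k : ℕ) :
    HasModulus θ (modulusConst θ C) (contractionRate θ C ^ k * D)
      fun x => (L ^ k) g x / (L ^ k) 1 x := by
  induction k with
  | zero => simpa using h
  | succ k ih =>
    have h0 := T.contractionRate_pos
    have := T.hasModulus_succ (by positivity) g k ih
    rwa [← mul_assoc, ← pow_succ'] at this

/-- The normalized iterates of later times are averages of those of earlier times. -/
theorem div_mem_Icc_of_forall (T : IsTransferOp φ θ C b L) (g : ShiftSpace →ᵇ ℝ) {k : ℕ}
    {m M : ℝ} (h : ∀ x, (L ^ k) g x / (L ^ k) 1 x ∈ Icc m M) (j : ℕ) (y : ShiftSpace) :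
    (L ^ (j + k)) g y / (L ^ (j + k)) 1 y ∈ Icc m M := by
  have hpos := T.pow_one_pos (j + k) y
  have h1 : ∀ (c : ℝ), (L ^ (j + k)) (c • 1) y = c * (L ^ (j + k)) 1 y := fun c => by
    rw [map_smul]; rfl
  have hk : ∀ f : ShiftSpace →ᵇ ℝ, (L ^ (j + k)) f = (L ^ j) ((L ^ k) f) := fun f => by
    rw [pow_add]; rfl
  constructor
  · rw [le_div_iff₀ hpos, ← h1, hk, hk]
    refine T.pow_mono (fun x => ?_) j y
    rw [map_smul]
    exact (le_div_iff₀ (T.pow_one_pos k x)).1 (h x).1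
  · rw [div_le_iff₀ hpos, ← h1, hk, hk]
    refine T.pow_mono (fun x => ?_) j y
    rw [map_smul]
    exact (div_le_iff₀ (T.pow_one_pos k x)).1 (h x).2

/-- At time k the oscillation is at most κ^k D, and later normalized iterates stay within any bounds
valid at time k. This is the uniform Cauchy estimate. -/
theorem abs_div_sub_div_le (T : IsTransferOp φ θ C b L) {D : ℝ} (hD : 0 ≤ D)
    (g : ShiftSpace →ᵇ ℝ) (h : HasModulus θ (modulusConst θ C) D g) (k j : ℕ)
    (x y : ShiftSpace) :
    |(L ^ (j + k)) g y / (L ^ (j + k)) 1 y - (L ^ k) g x / (L ^ k) 1 x| ≤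
      contractionRate θ C ^ k * D := by
  have h0 := T.contractionRate_pos
  have hk := T.hasModulus_pow hD g h k
  have hosc : ∀ u v, (L ^ k) g u / (L ^ k) 1 u - (L ^ k) g v / (L ^ k) 1 v ≤
      contractionRate θ C ^ k * D := fun u v =>
    (hk 0 u v (agreeUpTo_zero u v)).trans
      (mul_le_of_le_one_right (by positivity)
        (by linarith [Real.exp_pos (-(modulusConst θ C * θ ^ 0))]))
  have := T.div_mem_Icc_of_forall g (k := k)
    (m := (L ^ k) g x / (L ^ k) 1 x - contractionRate θ C ^ k * D)
    (M := (L ^ k) g x / (L ^ k) 1 x + contractionRate θ C ^ k * D)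
    (fun u => ⟨by linarith [hosc x u], by linarith [hosc u x]⟩) j y
  rw [abs_le]
  constructor <;> linarith [this.1, this.2]

end IsTransferOp

end CountableIFS

/-! ### Sums over words, tightness and the limit measure. -/

namespace CountableIFS

/-- The sequence `w x` obtained by writing the finite word `w` in front of `x`. -/
def prependWord : {n : ℕ} → (Fin n → ℕ) → ShiftSpace → ShiftSpace
  | 0, _, x => x
  | _ + 1, w, x => prepend (w 0) (prependWord (Fin.tail w) x)

theorem prependWord_cons {n : ℕ} (i : ℕ) (w : Fin n → ℕ) (x : ShiftSpace) :
    prependWord (Fin.cons i w : Fin (n + 1) → ℕ) x = prepend i (prependWord w x) := by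
  simp [prependWord]

theorem shift_prepend (i : ℕ) (x : ShiftSpace) : shift (prepend i x) = x := rfl

theorem birkhoffSum_prepend (φ : ShiftSpace → ℝ) (n i : ℕ) (x : ShiftSpace) :
    birkhoffSum shift φ (n + 1) (prepend i x) = φ (prepend i x) + birkhoffSum shift φ n x := by
  rw [birkhoffSum_succ', shift_prepend]

/-- Words of length `n + 1` are pairs of a word of length `n` and a first letter. -/
def consWordEquiv (n : ℕ) : (Fin n → ℕ) × ℕ ≃ (Fin (n + 1) → ℕ) :=
  (Equiv.prodComm _ _).trans (Fin.consEquiv fun _ => ℕ)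

theorem consWordEquiv_apply (n : ℕ) (p : (Fin n → ℕ) × ℕ) :
    consWordEquiv n p = Fin.cons p.2 p.1 := rfl

namespace IsTransferOp

variable {φ : ShiftSpace → ℝ} {θ C : ℝ} {b : ℕ → ℝ}
  {L : (ShiftSpace →ᵇ ℝ) →L[ℝ] (ShiftSpace →ᵇ ℝ)}

/-- Summing over the first letter of a word of length n + 1 turns the term of its tail w into that
term times L1(wx) ≤ ‖L1‖. -/
theorem summable_exp_birkhoffSum (T : IsTransferOp φ θ C b L) (n : ℕ) (x : ShiftSpace) :
    Summable fun w : Fin n → ℕ => Real.exp (birkhoffSum shift φ n (prependWord w x)) := by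
  induction n with
  | zero => exact (hasSum_unique _).summable
  | succ n ih =>
    rw [← (consWordEquiv n).summable_iff]
    have hfib : ∀ w : Fin n → ℕ, HasSum (fun i : ℕ => Real.exp (birkhoffSum shift φ (n + 1)
        (prependWord (consWordEquiv n (w, i)) x)))
        (Real.exp (birkhoffSum shift φ n (prependWord w x)) * L 1 (prependWord w x)) := by
      intro w
      refine ((T.hasSum 1 (prependWord w x)).mul_left
        (Real.exp (birkhoffSum shift φ n (prependWord w x)))).congr_fun fun i => ?_
      rw [consWordEquiv_apply, prependWord_cons, birkhoffSum_prepend, Real.exp_add]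
      change _ = _ * (_ * 1)
      ring
    refine (summable_prod_of_nonneg fun _ => (Real.exp_pos _).le).2
      ⟨fun w => (hfib w).summable, ?_⟩
    refine Summable.of_nonneg_of_le (fun w => tsum_nonneg fun _ => (Real.exp_pos _).le) (fun w => ?_)
      (ih.mul_right ‖L 1‖)
    refine (hfib w).tsum_eq.trans_le ?_
    exact mul_le_mul_of_nonneg_left ((le_abs_self _).trans ((L 1).norm_coe_le_norm _))
      (Real.exp_pos _).le

/-- The iterates of the transfer operator as sums over words. -/
theorem hasSum_pow (T : IsTransferOp φ θ C b L) (n : ℕ) : ∀ (g : ShiftSpace →ᵇ ℝ)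
    (x : ShiftSpace), HasSum (fun w : Fin n → ℕ =>
      Real.exp (birkhoffSum shift φ n (prependWord w x)) * g (prependWord w x))
      ((L ^ n) g x) := by
  induction n with
  | zero =>
    intro g x
    convert hasSum_unique (fun w : Fin 0 → ℕ =>
      Real.exp (birkhoffSum shift φ 0 (prependWord w x)) * g (prependWord w x)) using 1
    simp [prependWord]
  | succ n ih =>
    intro g x
    rw [← (consWordEquiv n).hasSum_iff]
    have hs : Summable ((fun w : Fin (n + 1) → ℕ =>
        Real.exp (birkhoffSum shift φ (n + 1) (prependWord w x)) * g (prependWord w x)) ∘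
        consWordEquiv n) := by
      refine (consWordEquiv n).summable_iff.2 (Summable.of_norm_bounded
        ((T.summable_exp_birkhoffSum (n + 1) x).mul_right ‖g‖) fun w => ?_)
      rw [norm_mul, Real.norm_of_nonneg (Real.exp_pos _).le]
      exact mul_le_mul_of_nonneg_left (g.norm_coe_le_norm _) (Real.exp_pos _).le
    have hfib : ∀ w : Fin n → ℕ, HasSum (fun i : ℕ => ((fun w : Fin (n + 1) → ℕ =>
        Real.exp (birkhoffSum shift φ (n + 1) (prependWord w x)) * g (prependWord w x)) ∘
        consWordEquiv n) (w, i))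
        (Real.exp (birkhoffSum shift φ n (prependWord w x)) * L g (prependWord w x)) := by
      intro w
      refine ((T.hasSum g (prependWord w x)).mul_left
        (Real.exp (birkhoffSum shift φ n (prependWord w x)))).congr_fun fun i => ?_
      simp only [Function.comp_apply]
      rw [consWordEquiv_apply, prependWord_cons, birkhoffSum_prepend, Real.exp_add]
      ring
    -- Summing over the first letter produces L g at wx, so the induction hypothesis is applied to L
    -- g and L^{n+1} is read as L^n L.
    have h1 := (hs.hasSum.prod_fiberwise hfib).unique (ih (L g) x)
    rw [pow_succ, mul_apply_eq_comp]
    rw [← h1]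
    exact hs.hasSum

/-- The functional `g ↦ L ^ n g x / L ^ n 1 x` is a probability measure. -/
theorem exists_probabilityMeasure (T : IsTransferOp φ θ C b L) (n : ℕ) (x : ShiftSpace) :
    ∃ μ : ProbabilityMeasure ShiftSpace, ∀ g : ShiftSpace →ᵇ ℝ,
      ∫ ω, g ω ∂(μ : Measure ShiftSpace) = (L ^ n) g x / (L ^ n) 1 x := by
  set l := (L ^ n) 1 x with hl
  have hlpos : 0 < l := T.pow_one_pos n x
  set p : (Fin n → ℕ) → ℝ := fun w =>
    Real.exp (birkhoffSum shift φ n (prependWord w x)) / l with hp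
  have hp0 : ∀ w, 0 ≤ p w := fun w => (div_pos (Real.exp_pos _) hlpos).le
  have hp1 : HasSum p 1 := by
    have := (T.hasSum_pow n 1 x).div_const l
    rw [div_self hlpos.ne'] at this
    refine this.congr_fun fun w => ?_
    change _ = (_ * 1) / l
    rw [mul_one]
  set μ : Measure ShiftSpace := Measure.sum fun w : Fin n → ℕ =>
    ENNReal.ofReal (p w) • Measure.dirac (prependWord w x) with hμ
  have hprob : IsProbabilityMeasure μ := by
    constructor
    rw [hμ, Measure.sum_apply _ MeasurableSet.univ]
    simp only [Measure.smul_apply, measure_univ, smul_eq_mul, mul_one]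
    rw [← ENNReal.ofReal_tsum_of_nonneg hp0 hp1.summable, hp1.tsum_eq, ENNReal.ofReal_one]
  refine ⟨⟨μ, hprob⟩, fun g => ?_⟩
  change ∫ ω, g ω ∂μ = _
  have h1 := hasSum_integral_measure (μ := fun w : Fin n → ℕ =>
    ENNReal.ofReal (p w) • Measure.dirac (prependWord w x)) (g.integrable μ)
  refine h1.unique (((T.hasSum_pow n g x).div_const l).congr_fun fun w => ?_)
  rw [integral_smul_measure, ENNReal.toReal_ofReal (hp0 w), integral_dirac, smul_eq_mul, hp]
  ring

end IsTransferOp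

/-- The indicator function of `{x | m < x j}`. -/
noncomputable def tailIndicator (j m : ℕ) : ShiftSpace →ᵇ ℝ :=
  BoundedContinuousFunction.ofNormedAddCommGroup
    (fun x : ShiftSpace => if m < x j then (1 : ℝ) else 0)
    ((continuous_of_discreteTopology (f := fun k : ℕ => if m < k then (1 : ℝ) else 0)).comp
      (continuous_apply j)) 1
    (fun x => by split_ifs <;> simp)

theorem tailIndicator_apply (j m : ℕ) (x : ShiftSpace) :
    tailIndicator j m x = if m < x j then 1 else 0 := rfl

theorem tailIndicator_nonneg (j m : ℕ) (x : ShiftSpace) : 0 ≤ tailIndicator j m x := by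
  rw [tailIndicator_apply]; split_ifs <;> simp

namespace IsTransferOp

variable {φ : ShiftSpace → ℝ} {θ C : ℝ} {b : ℕ → ℝ}
  {L : (ShiftSpace →ᵇ ℝ) →L[ℝ] (ShiftSpace →ᵇ ℝ)}

theorem bound_nonneg (T : IsTransferOp φ θ C b L) (i : ℕ) : 0 ≤ b i :=
  (Real.exp_pos _).le.trans (T.weight_le i 0)

/-- Only the preimages ix with i ≥ m + 1 contribute, each with weight at most `b i`. -/
theorem apply_tailIndicator_zero_le (T : IsTransferOp φ θ C b L) (m : ℕ) (x : ShiftSpace) :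
    L (tailIndicator 0 m) x ≤ ∑' i, b (i + (m + 1)) := by
  have hs : HasSum (fun i => Real.exp (φ (prepend (i + (m + 1)) x)) *
      tailIndicator 0 m (prepend (i + (m + 1)) x)) (L (tailIndicator 0 m) x) := by
    have := (hasSum_nat_add_iff' (m + 1)).2 (T.hasSum (tailIndicator 0 m) x)
    rwa [Finset.sum_eq_zero, sub_zero] at this
    intro i hi
    rw [tailIndicator_apply, if_neg, mul_zero]
    exact not_lt.2 (Nat.lt_succ_iff.1 (Finset.mem_range.1 hi))
  refine hasSum_le (fun i => ?_) hs ((summable_nat_add_iff (m + 1)).2 T.summable).hasSum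
  refine le_trans ?_ (T.weight_le _ x)
  rw [tailIndicator_apply]
  split_ifs
  · rw [mul_one]
  · rw [mul_zero]; exact (Real.exp_pos _).le

theorem apply_tailIndicator_succ (T : IsTransferOp φ θ C b L) (j m : ℕ) (x : ShiftSpace) :
    L (tailIndicator (j + 1) m) x = tailIndicator j m x * L 1 x := by
  refine (T.hasSum _ x).unique (((T.hasSum 1 x).mul_left (tailIndicator j m x)).congr_fun ?_)
  intro i
  change _ * tailIndicator j m x = tailIndicator j m x * (_ * 1)
  ring

/-- Uniform smallness of the tails of the functionals `g ↦ L ^ k g 0 / L ^ k 1 0`. -/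
theorem pow_tailIndicator_le (T : IsTransferOp φ θ C b L) : ∃ r : ℝ, 0 < r ∧ ∀ k j m : ℕ,
    (L ^ k) (tailIndicator j m) 0 ≤ r ^ (j + 1) * (∑' i, b (i + (m + 1))) * (L ^ k) 1 0 := by
  set S := ‖L 1‖ with hS
  -- By distortion c is a lower bound for L1, so c L^k 1 ≤ L^{k+1} 1. Each induction step on k below
  -- exchanges L^k 1 for L^{k+1} 1 at the price 1/c.
  set c := Real.exp (-distortion θ C) * L 1 0 with hc
  have hL1 : ∀ x, 0 < L 1 x := fun x => by simpa using T.pow_one_pos 1 x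
  have hcpos : 0 < c := mul_pos (Real.exp_pos _) (hL1 0)
  have hcle : ∀ x, c ≤ L 1 x := fun x => by
    have := T.pow_one_le_const 1 0 x
    rw [pow_one] at this
    rw [hc, Real.exp_neg, inv_mul_le_iff₀ (Real.exp_pos _)]
    exact this
  have hSpos : 0 < S := (hL1 0).trans_le ((le_abs_self _).trans ((L 1).norm_coe_le_norm _))
  set r := max (1 / c) (S / c) with hr
  have hrpos : 0 < r := lt_max_of_lt_left (by positivity)
  have ht : ∀ m, 0 ≤ ∑' i, b (i + (m + 1)) := fun m => tsum_nonneg fun _ => T.bound_nonneg _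
  have hsucc : ∀ k : ℕ, c * (L ^ k) 1 0 ≤ (L ^ (k + 1)) 1 0 := fun k => by
    rw [pow_succ, mul_apply_eq_comp]
    have := T.pow_mono (f := c • 1) (g := L 1) (fun x => by
      change c * 1 ≤ _; rw [mul_one]; exact hcle x) k 0
    rw [map_smul] at this
    exact this
  refine ⟨r, hrpos, fun k => ?_⟩
  induction k with
  | zero =>
    intro j m
    -- The base point is the zero sequence, none of whose coordinates exceeds m.
    have : (L ^ 0) (tailIndicator j m) 0 = 0 := by
      change tailIndicator j m 0 = 0
      rw [tailIndicator_apply, if_neg (by simp)]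
    rw [this]
    have := T.pow_one_pos 0 0
    have := ht m
    positivity
  | succ k ih =>
    intro j m
    have hk := T.pow_one_pos k 0
    have htm := ht m
    have hk' := hsucc k
    rw [pow_succ, mul_apply_eq_comp, ← pow_succ]
    cases j with
    | zero =>
      have h1 := T.pow_mono (f := L (tailIndicator 0 m)) (g := (∑' i, b (i + (m + 1))) • 1)
        (fun x => by
          change _ ≤ (∑' i, b (i + (m + 1))) * 1
          rw [mul_one]; exact T.apply_tailIndicator_zero_le m x) k 0
      rw [map_smul] at h1
      change _ ≤ (∑' i, b (i + (m + 1))) * (L ^ k) 1 0 at h1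
      have h2 : (L ^ k) 1 0 ≤ r * (L ^ (k + 1)) 1 0 := by
        have : 1 / c * (c * (L ^ k) 1 0) = (L ^ k) 1 0 := by field_simp
        calc _ = 1 / c * (c * (L ^ k) 1 0) := this.symm
          _ ≤ r * (L ^ (k + 1)) 1 0 :=
            mul_le_mul (le_max_left _ _) hk' (by positivity) hrpos.le
      have := mul_le_mul_of_nonneg_left h2 htm
      rw [zero_add, pow_one]
      linarith
    | succ j =>
      have h1 := T.pow_mono (f := L (tailIndicator (j + 1) m)) (g := S • tailIndicator j m)
        (fun x => by
          rw [T.apply_tailIndicator_succ]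
          change _ ≤ S * tailIndicator j m x
          rw [mul_comm]
          exact mul_le_mul_of_nonneg_right ((le_abs_self _).trans ((L 1).norm_coe_le_norm _))
            (tailIndicator_nonneg _ _ _)) k 0
      rw [map_smul] at h1
      change _ ≤ S * (L ^ k) (tailIndicator j m) 0 at h1
      have h2 : S * (L ^ k) 1 0 ≤ r * (L ^ (k + 1)) 1 0 := by
        have : S / c * (c * (L ^ k) 1 0) = S * (L ^ k) 1 0 := by field_simp
        calc _ = S / c * (c * (L ^ k) 1 0) := this.symm
          _ ≤ r * (L ^ (k + 1)) 1 0 :=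
            mul_le_mul (le_max_right _ _) hk' (by positivity) hrpos.le
      have h3 := mul_le_mul_of_nonneg_left (ih j m) hSpos.le
      have h4 := mul_le_mul_of_nonneg_left h2
        (mul_nonneg (pow_nonneg hrpos.le (j + 1)) htm)
      calc _ ≤ _ := h1
        _ ≤ _ := h3
        _ = r ^ (j + 1) * (∑' i, b (i + (m + 1))) * (S * (L ^ k) 1 0) := by ring
        _ ≤ _ := h4
        _ = _ := by ring

/-- The functionals `g ↦ L ^ k g 0 / L ^ k 1 0` have a limit point among the probability
measures. -/
theorem exists_limit_measure (T : IsTransferOp φ θ C b L) :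
    ∃ (U : Ultrafilter ℕ) (ν : ProbabilityMeasure ShiftSpace), (U : Filter ℕ) ≤ atTop ∧
      ∀ g : ShiftSpace →ᵇ ℝ, Tendsto (fun k => (L ^ k) g 0 / (L ^ k) 1 0) U
        (𝓝 (∫ ω, g ω ∂(ν : Measure ShiftSpace))) := by
  choose μ hμ using fun k => T.exists_probabilityMeasure k 0
  obtain ⟨r, hr, htail⟩ := T.pow_tailIndicator_le
  have hlim : Tendsto (fun m => ∑' i, b (i + (m + 1))) atTop (𝓝 0) :=
    (tendsto_sum_nat_add b).comp (tendsto_add_atTop_nat 1)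
  have hmeas : ∀ k j m, (μ k : Measure ShiftSpace) {x | m < x j} ≤
      ENNReal.ofReal (r ^ (j + 1) * ∑' i, b (i + (m + 1))) := by
    intro k j m
    have hset : MeasurableSet {x : ShiftSpace | m < x j} :=
      measurableSet_lt measurable_const (measurable_pi_apply j)
    have h1 : ∫ ω, tailIndicator j m ω ∂(μ k : Measure ShiftSpace) =
        (μ k : Measure ShiftSpace).real {x | m < x j} := by
      rw [← integral_indicator_one hset]
      congr 1
      ext x
      rw [tailIndicator_apply, indicator_apply]
      rfl
    rw [← ENNReal.ofReal_toReal (measure_ne_top (μ k : Measure ShiftSpace) {x | m < x j})]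
    refine ENNReal.ofReal_le_ofReal ?_
    change (μ k : Measure ShiftSpace).real {x | m < x j} ≤ _
    rw [← h1, hμ, div_le_iff₀ (T.pow_one_pos k 0)]
    exact htail k j m
  have htight : IsTightMeasureSet
      {((ρ : ProbabilityMeasure ShiftSpace) : Measure ShiftSpace) | ρ ∈ range μ} := by
    rw [isTightMeasureSet_iff_exists_isCompact_measure_compl_le]
    intro ε hε
    obtain ⟨δ, hδ0, hδ⟩ := ENNReal.exists_pos_sum_of_countable' hε.ne' ℕ
    -- The tail bound may grow with j as long as it is uniform in k: each coordinate gets its own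
    -- cutoff, and the product of the resulting finite sets is compact.
    have hex : ∀ j, ∃ m, ENNReal.ofReal (r ^ (j + 1) * ∑' i, b (i + (m + 1))) ≤ δ j := by
      intro j
      have : Tendsto (fun m => ENNReal.ofReal (r ^ (j + 1) * ∑' i, b (i + (m + 1)))) atTop
          (𝓝 0) := by
        have := ENNReal.tendsto_ofReal (hlim.const_mul (r ^ (j + 1)))
        rwa [mul_zero, ENNReal.ofReal_zero] at this
      exact (this.eventually (ge_mem_nhds (hδ0 j))).exists
    choose m hm using hex
    refine ⟨Set.pi univ fun j => Iic (m j), isCompact_univ_pi fun j => (finite_Iic _).isCompact,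
      ?_⟩
    rintro _ ⟨_, ⟨k, rfl⟩, rfl⟩
    have hsub : (Set.pi univ fun j => Iic (m j))ᶜ ⊆ ⋃ j, {x : ShiftSpace | m j < x j} := by
      intro x hx
      simpa [Set.mem_pi, Pi.le_def] using hx
    calc (μ k : Measure ShiftSpace) _ ≤ _ := measure_mono hsub
      _ ≤ ∑' j, (μ k : Measure ShiftSpace) {x | m j < x j} := measure_iUnion_le _
      _ ≤ ∑' j, δ j := ENNReal.tsum_le_tsum fun j => (hmeas k j (m j)).trans (hm j)
      _ ≤ ε := hδ.le
  have hcomp := isCompact_closure_of_isTightMeasureSet htight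
  -- Along an ultrafilter finer than `atTop`, compactness gives convergence for all test functions
  -- at once.
  set U : Ultrafilter ℕ := Ultrafilter.of atTop with hU
  obtain ⟨ν, -, hν⟩ := hcomp.ultrafilter_le_nhds (U.map μ)
    (le_principal_iff.2 (mem_map.2 (Eventually.of_forall fun k => subset_closure ⟨k, rfl⟩)))
  refine ⟨U, ν, Ultrafilter.of_le _, fun g => ?_⟩
  have h1 : Tendsto μ U (𝓝 ν) := hν
  exact ((ProbabilityMeasure.tendsto_iff_forall_integral_tendsto.1 h1) g).congr fun k => hμ k g

end IsTransferOp

end CountableIFS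

/-! ### Truncation, the eigenmeasure, the eigenfunction and convergence. -/

namespace CountableIFS

/-- Keep the first `n` coordinates and replace the others by `0`. -/
def truncation (n : ℕ) (x : ShiftSpace) : ShiftSpace := fun k => if k < n then x k else 0

theorem continuous_truncation (n : ℕ) : Continuous (truncation n) := by
  refine continuous_pi fun k => ?_
  by_cases hk : k < n
  · simpa [truncation, hk] using continuous_apply k
  · simpa [truncation, hk] using continuous_const

theorem agreeUpTo_truncation (n : ℕ) (x : ShiftSpace) : AgreeUpTo n (truncation n x) x :=
  fun _ hk => if_pos hk

theorem AgreeUpTo.truncation_eq {n m : ℕ} {x y : ShiftSpace} (h : AgreeUpTo m x y) (hnm : n ≤ m) :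
    truncation n x = truncation n y := by
  ext k
  unfold truncation
  split_ifs with hk
  · exact h k (hk.trans_le hnm)
  · rfl

theorem tendsto_truncation (x : ShiftSpace) :
    Tendsto (fun n => truncation n x) atTop (𝓝 x) := by
  rw [tendsto_pi_nhds]
  intro k
  refine tendsto_const_nhds.congr' ?_
  filter_upwards [eventually_gt_atTop k] with n hn
  exact (if_pos hn).symm

/-- The function `x ↦ g (x₀, …, x_{n-1}, 0, 0, …)`. -/
def truncate (n : ℕ) (g : ShiftSpace →ᵇ ℝ) : ShiftSpace →ᵇ ℝ :=
  g.compContinuous ⟨truncation n, continuous_truncation n⟩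

theorem truncate_apply (n : ℕ) (g : ShiftSpace →ᵇ ℝ) (x : ShiftSpace) :
    truncate n g x = g (truncation n x) := rfl

theorem norm_truncate_le (n : ℕ) (g : ShiftSpace →ᵇ ℝ) : ‖truncate n g‖ ≤ ‖g‖ :=
  (BoundedContinuousFunction.norm_le (norm_nonneg _)).2 fun _ => g.norm_coe_le_norm _

theorem tendsto_truncate (g : ShiftSpace →ᵇ ℝ) (x : ShiftSpace) :
    Tendsto (fun n => truncate n g x) atTop (𝓝 (g x)) :=
  (g.continuous.tendsto x).comp (tendsto_truncation x)

/-- Pairs agreeing in the first n coordinates tend, as n grows, to the diagonal in the product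
uniformity. -/
theorem exists_agreeUpTo_of_uniformContinuous {g : ShiftSpace → ℝ} (hg : UniformContinuous g)
    {ε : ℝ} (hε : 0 < ε) : ∃ n, ∀ x y, AgreeUpTo n x y → |g x - g y| < ε := by
  by_contra! hcon
  choose x y hxy hge using hcon
  have h1 : Tendsto (fun n => (x n, y n)) atTop (uniformity ShiftSpace) := by
    rw [Pi.uniformity, tendsto_iInf]
    intro i
    rw [tendsto_comap_iff]
    intro V hV
    rw [mem_map]
    filter_upwards [eventually_gt_atTop i] with n hn
    have := hxy n i hn
    simp only [mem_preimage, Function.comp_apply, this]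
    exact refl_mem_uniformity hV
  have h2 := (Tendsto.comp hg h1).eventually (Metric.dist_mem_uniformity hε)
  obtain ⟨n, hn⟩ := h2.exists
  exact absurd hn (not_lt.2 (hge n))

theorem tendsto_truncate_of_uniformContinuous {g : ShiftSpace →ᵇ ℝ} (hg : UniformContinuous g) :
    Tendsto (fun n => truncate n g) atTop (𝓝 g) := by
  rw [Metric.tendsto_atTop]
  intro ε hε
  obtain ⟨n, hn⟩ := exists_agreeUpTo_of_uniformContinuous hg (half_pos hε)
  refine ⟨n, fun m hm => ?_⟩
  refine lt_of_le_of_lt ((BoundedContinuousFunction.dist_le (half_pos hε).le).2 fun x => ?_)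
    (half_lt_self hε)
  rw [Real.dist_eq]
  exact (hn _ _ fun k hk => agreeUpTo_truncation m x k (hk.trans_le hm)).le

/-- A truncation is constant on cylinders of length n, so only agreement lengths m ≤ n matter, where
the modulus is at least its value at n. Truncations thus serve as the approximating class. -/
theorem hasModulus_truncate {θ B : ℝ} (hθ0 : 0 < θ) (hθ1 : θ < 1) (hB : 0 < B) (n : ℕ)
    (g : ShiftSpace →ᵇ ℝ) : ∃ D, 0 ≤ D ∧ HasModulus θ B D (truncate n g) := by
  have hpos : ∀ m : ℕ, 0 < 1 - Real.exp (-(B * θ ^ m)) := fun m => by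
    have : Real.exp (-(B * θ ^ m)) < 1 := Real.exp_lt_one_iff.2 (neg_lt_zero.2 (by positivity))
    linarith
  refine ⟨2 * ‖g‖ / (1 - Real.exp (-(B * θ ^ n))), div_nonneg (by positivity) (hpos n).le, ?_⟩
  intro m x y hxy
  have h0 := hpos n
  have h1 := hpos m
  rcases le_total n m with hnm | hmn
  · rw [truncate_apply, truncate_apply, hxy.truncation_eq hnm, sub_self]
    positivity
  · have h2 : g (truncation n x) - g (truncation n y) ≤ 2 * ‖g‖ := by
      have h3 := (abs_le.1 (g.norm_coe_le_norm (truncation n x))).2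
      have h4 := (abs_le.1 (g.norm_coe_le_norm (truncation n y))).1
      linarith
    have h5 : 1 - Real.exp (-(B * θ ^ n)) ≤ 1 - Real.exp (-(B * θ ^ m)) := by
      have : θ ^ n ≤ θ ^ m := pow_le_pow_of_le_one hθ0.le hθ1.le hmn
      have := Real.exp_le_exp.2 (neg_le_neg (mul_le_mul_of_nonneg_left this hB.le))
      linarith
    rw [div_mul_eq_mul_div, le_div_iff₀ h0]
    exact mul_le_mul h2 h5 h0.le (by positivity)

theorem hasModulus_of_le_pow {θ B A : ℝ} (hθ0 : 0 < θ) (hθ1 : θ < 1) (hB : 0 < B) (hA : 0 ≤ A)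
    {f : ShiftSpace → ℝ} (h : ∀ n x y, AgreeUpTo n x y → f x - f y ≤ A * θ ^ n) :
    HasModulus θ B (A / (Real.exp (-B) * B)) f := by
  intro n x y hxy
  have h1 := le_one_sub_exp_neg hB.le (pow_pos hθ0 n).le (pow_le_one₀ hθ0.le hθ1.le)
  refine (h n x y hxy).trans ?_
  have h2 : 0 < Real.exp (-B) * B := mul_pos (Real.exp_pos _) hB
  rw [div_mul_eq_mul_div, le_div_iff₀ h2]
  nlinarith [mul_le_mul_of_nonneg_left h1 hA]

/-- Multiplicative distortion becomes an additive Hölder bound through e^t - 1 ≤ t e^t. It is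
applied to L1 and to h. -/
theorem sub_le_of_le_exp_mul {θ K S : ℝ} (hθ0 : 0 < θ) (hθ1 : θ < 1) (hK : 0 < K)
    {f : ShiftSpace → ℝ} (hS : ∀ x, f x ≤ S) (h0 : ∀ x, 0 ≤ f x)
    (h : ∀ n x y, AgreeUpTo n x y → f x ≤ Real.exp (K * θ ^ n) * f y) (n : ℕ)
    (x y : ShiftSpace) (hxy : AgreeUpTo n x y) : f x - f y ≤ S * Real.exp K * K * θ ^ n := by
  have ht0 : 0 < θ ^ n := pow_pos hθ0 n
  have ht1 : θ ^ n ≤ 1 := pow_le_one₀ hθ0.le hθ1.le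
  have h1 := Real.add_one_le_exp (-(K * θ ^ n))
  have h2 : Real.exp (-(K * θ ^ n)) * Real.exp (K * θ ^ n) = 1 := by rw [← Real.exp_add]; simp
  have h3 : Real.exp (K * θ ^ n) ≤ Real.exp K := Real.exp_le_exp.2 (by nlinarith)
  have h4 : Real.exp (K * θ ^ n) - 1 ≤ Real.exp K * (K * θ ^ n) := by
    have h5 : 0 ≤ K * θ ^ n := by positivity
    nlinarith [Real.exp_pos (K * θ ^ n)]
  calc f x - f y ≤ (Real.exp (K * θ ^ n) - 1) * f y := by linarith [h n x y hxy]
    _ ≤ Real.exp K * (K * θ ^ n) * f y := mul_le_mul_of_nonneg_right h4 (h0 y)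
    _ ≤ Real.exp K * (K * θ ^ n) * S := mul_le_mul_of_nonneg_left (hS y) (by positivity)
    _ = _ := by ring

namespace IsTransferOp

variable {φ : ShiftSpace → ℝ} {θ C : ℝ} {b : ℕ → ℝ}
  {L : (ShiftSpace →ᵇ ℝ) →L[ℝ] (ShiftSpace →ᵇ ℝ)}

theorem tendsto_apply_truncate (T : IsTransferOp φ θ C b L) (g : ShiftSpace →ᵇ ℝ)
    (x : ShiftSpace) : Tendsto (fun n => L (truncate n g) x) atTop (𝓝 (L g x)) := by
  have h1 : ∀ f : ShiftSpace →ᵇ ℝ,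
      L f x = ∑' i, Real.exp (φ (prepend i x)) * f (prepend i x) :=
    fun f => (T.hasSum f x).tsum_eq.symm
  simp only [h1]
  refine tendsto_tsum_of_dominated_convergence (T.summable.mul_right ‖g‖)
    (fun i => (tendsto_truncate g _).const_mul _) (Eventually.of_forall fun n i => ?_)
  rw [norm_mul, Real.norm_of_nonneg (Real.exp_pos _).le]
  exact mul_le_mul (T.weight_le i x) (g.norm_coe_le_norm _) (norm_nonneg _) (T.bound_nonneg i)

/-- Existence of the eigenmeasure, with the exponential convergence of the normalized iterates. -/
theorem exists_eigenmeasure (T : IsTransferOp φ θ C b L) :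
    ∃ (ν : ProbabilityMeasure ShiftSpace) (lam : ℝ), 0 < lam ∧
      (∀ g : ShiftSpace →ᵇ ℝ, ∫ ω, L g ω ∂(ν : Measure ShiftSpace) =
        lam * ∫ ω, g ω ∂(ν : Measure ShiftSpace)) ∧
      ∀ (D : ℝ) (g : ShiftSpace →ᵇ ℝ), 0 ≤ D → HasModulus θ (modulusConst θ C) D g →
        ∀ k x, |(L ^ k) g x / (L ^ k) 1 x - ∫ ω, g ω ∂(ν : Measure ShiftSpace)| ≤
          contractionRate θ C ^ k * D := by
  obtain ⟨U, ν, hU, hν⟩ := T.exists_limit_measure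
  have hκ0 := T.contractionRate_pos
  have hκ1 := T.contractionRate_lt_one
  have hest : ∀ (D : ℝ) (g : ShiftSpace →ᵇ ℝ), 0 ≤ D → HasModulus θ (modulusConst θ C) D g →
        ∀ k x, |(L ^ k) g x / (L ^ k) 1 x - ∫ ω, g ω ∂(ν : Measure ShiftSpace)| ≤
          contractionRate θ C ^ k * D := by
    intro D g hD hg k x
    -- Let the later time in the Cauchy estimate tend to infinity along U.
    refine le_of_tendsto (((hν g).const_sub _).abs) ?_
    filter_upwards [hU (eventually_ge_atTop k)] with j hj
    obtain ⟨j, rfl⟩ := Nat.exists_eq_add_of_le' hj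
    rw [abs_sub_comm]
    exact T.abs_div_sub_div_le hD g hg k j x 0
  have hlam : 0 < ∫ ω, L 1 ω ∂(ν : Measure ShiftSpace) := by
    have h1 : 0 < Real.exp (-distortion θ C) * L 1 0 :=
      mul_pos (Real.exp_pos _) (by simpa using T.pow_one_pos 1 0)
    have h2 : ∫ _, Real.exp (-distortion θ C) * L 1 0 ∂(ν : Measure ShiftSpace) ≤
        ∫ ω, L 1 ω ∂(ν : Measure ShiftSpace) := by
      refine integral_mono (integrable_const _) ((L 1).integrable _) fun x => ?_
      have := T.pow_one_le_const 1 0 x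
      rw [pow_one] at this
      rw [Real.exp_neg, inv_mul_le_iff₀ (Real.exp_pos _)]
      exact this
    rw [integral_const, probReal_univ, one_smul] at h2
    exact h1.trans_le h2
  have hmod : ∀ (D : ℝ) (g : ShiftSpace →ᵇ ℝ), 0 ≤ D → HasModulus θ (modulusConst θ C) D g →
      ∫ ω, L g ω ∂(ν : Measure ShiftSpace) =
        (∫ ω, L 1 ω ∂(ν : Measure ShiftSpace)) * ∫ ω, g ω ∂(ν : Measure ShiftSpace) := by
    intro D g hD hg
    have h1 : Tendsto (fun k => (L ^ k) g 0 / (L ^ k) 1 0) atTop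
        (𝓝 (∫ ω, g ω ∂(ν : Measure ShiftSpace))) := by
      rw [tendsto_iff_dist_tendsto_zero]
      have h2 : Tendsto (fun k => contractionRate θ C ^ k * D) atTop (𝓝 0) := by
        simpa using (tendsto_pow_atTop_nhds_zero_of_lt_one hκ0.le hκ1).mul_const D
      exact squeeze_zero (fun _ => dist_nonneg) (fun k => hest D g hD hg k 0) h2
    have h2 := (h1.comp (tendsto_add_atTop_nat 1)).mono_left hU
    -- L^k(Lg) / L^k 1 is the product of L^k(L1) / L^k 1 and L^{k+1} g / L^{k+1} 1. The second
    -- factor needs a limit at shifted times, available because for g with a modulus the convergence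
    -- holds along all of `atTop`.
    have h3 := (hν (L 1)).mul h2
    refine tendsto_nhds_unique ((hν (L g))) (h3.congr fun k => ?_)
    have h4 := (T.pow_one_pos k 0).ne'
    have h5 := (T.pow_one_pos (k + 1) 0).ne'
    simp only [Function.comp_apply]
    rw [← mul_apply_eq_comp, ← mul_apply_eq_comp, ← pow_succ]
    field_simp
  refine ⟨ν, _, hlam, fun g => ?_, hest⟩
  -- For general g the truncations converge only pointwise; dominated convergence carries both sides
  -- of the identity to the limit.
  have h1 : Tendsto (fun n => ∫ ω, truncate n g ω ∂(ν : Measure ShiftSpace)) atTop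
      (𝓝 (∫ ω, g ω ∂(ν : Measure ShiftSpace))) := by
    refine tendsto_integral_of_dominated_convergence (fun _ => ‖g‖)
      (fun n => (truncate n g).continuous.aestronglyMeasurable) (integrable_const _)
      (fun n => Eventually.of_forall fun x => ?_)
      (Eventually.of_forall fun x => tendsto_truncate g x)
    exact g.norm_coe_le_norm _
  have h2 : Tendsto (fun n => ∫ ω, L (truncate n g) ω ∂(ν : Measure ShiftSpace)) atTop
      (𝓝 (∫ ω, L g ω ∂(ν : Measure ShiftSpace))) := by
    refine tendsto_integral_of_dominated_convergence (fun _ => ‖L‖ * ‖g‖)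
      (fun n => (L (truncate n g)).continuous.aestronglyMeasurable) (integrable_const _)
      (fun n => Eventually.of_forall fun x => ?_)
      (Eventually.of_forall fun x => T.tendsto_apply_truncate g x)
    refine ((L (truncate n g)).norm_coe_le_norm x).trans ((L.le_opNorm _).trans ?_)
    exact mul_le_mul_of_nonneg_left (norm_truncate_le n g) (norm_nonneg _)
  refine tendsto_nhds_unique h2 ((h1.const_mul _).congr fun n => ?_)
  obtain ⟨D, hD, hg⟩ := hasModulus_truncate T.theta_pos T.theta_lt_one T.modulusConst_pos n g
  exact (hmod D _ hD hg).symm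

section Eigenmeasure

variable {ν : ProbabilityMeasure ShiftSpace} {lam : ℝ}

theorem integral_pow (hν : ∀ g : ShiftSpace →ᵇ ℝ, ∫ ω, L g ω ∂(ν : Measure ShiftSpace) =
    lam * ∫ ω, g ω ∂(ν : Measure ShiftSpace)) (n : ℕ) (g : ShiftSpace →ᵇ ℝ) :
    ∫ ω, (L ^ n) g ω ∂(ν : Measure ShiftSpace) =
      lam ^ n * ∫ ω, g ω ∂(ν : Measure ShiftSpace) := by
  induction n with
  | zero => simp
  | succ n ih => rw [pow_succ', mul_apply_eq_comp, hν, ih, pow_succ', mul_assoc]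

theorem integral_pow_one (hν : ∀ g : ShiftSpace →ᵇ ℝ, ∫ ω, L g ω ∂(ν : Measure ShiftSpace) =
    lam * ∫ ω, g ω ∂(ν : Measure ShiftSpace)) (n : ℕ) :
    ∫ ω, (L ^ n) 1 ω ∂(ν : Measure ShiftSpace) = lam ^ n := by
  rw [integral_pow hν]
  change _ * ∫ _, (1 : ℝ) ∂(ν : Measure ShiftSpace) = _
  simp

/-- λ^n is the ν-average of L^n 1, and no value of L^n 1 exceeds e^K times another. The lower bound
that follows has the same source. -/
theorem inv_pow_mul_pow_one_le (T : IsTransferOp φ θ C b L) (hlam : 0 < lam)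
    (hν : ∀ g : ShiftSpace →ᵇ ℝ, ∫ ω, L g ω ∂(ν : Measure ShiftSpace) =
    lam * ∫ ω, g ω ∂(ν : Measure ShiftSpace)) (n : ℕ) (x : ShiftSpace) :
    (lam ^ n)⁻¹ * (L ^ n) 1 x ≤ Real.exp (distortion θ C) := by
  rw [inv_mul_le_iff₀ (pow_pos hlam n), ← integral_pow_one hν n, mul_comm,
    ← integral_const_mul]
  have : ∫ _, (L ^ n) 1 x ∂(ν : Measure ShiftSpace) = (L ^ n) 1 x := by simp
  rw [← this]
  exact integral_mono (integrable_const _) ((((L ^ n) 1).integrable _).const_mul _)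
    fun y => T.pow_one_le_const n x y

theorem le_inv_pow_mul_pow_one (T : IsTransferOp φ θ C b L) (hlam : 0 < lam)
    (hν : ∀ g : ShiftSpace →ᵇ ℝ, ∫ ω, L g ω ∂(ν : Measure ShiftSpace) =
    lam * ∫ ω, g ω ∂(ν : Measure ShiftSpace)) (n : ℕ) (x : ShiftSpace) :
    (Real.exp (distortion θ C))⁻¹ ≤ (lam ^ n)⁻¹ * (L ^ n) 1 x := by
  rw [← div_eq_inv_mul, le_div_iff₀ (pow_pos hlam n), inv_mul_le_iff₀ (Real.exp_pos _),
    ← integral_pow_one hν n]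
  have : ∫ _, Real.exp (distortion θ C) * (L ^ n) 1 x ∂(ν : Measure ShiftSpace) =
      Real.exp (distortion θ C) * (L ^ n) 1 x := by simp
  rw [← this]
  exact integral_mono (((L ^ n) 1).integrable _) (integrable_const _)
    fun y => T.pow_one_le_const n y x

theorem abs_pow_apply_le (T : IsTransferOp φ θ C b L) (n : ℕ) (g : ShiftSpace →ᵇ ℝ)
    (x : ShiftSpace) : |(L ^ n) g x| ≤ ‖g‖ * (L ^ n) 1 x := by
  have h1 : ∀ c : ℝ, (L ^ n) (c • 1) x = c * (L ^ n) 1 x := fun c => by rw [map_smul]; rfl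
  rw [abs_le, ← neg_mul, ← h1, ← h1]
  constructor
  · refine T.pow_mono (fun y => ?_) n x
    change -‖g‖ * 1 ≤ _
    rw [mul_one]
    exact (abs_le.1 (g.norm_coe_le_norm y)).1
  · refine T.pow_mono (fun y => ?_) n x
    change _ ≤ ‖g‖ * 1
    rw [mul_one]
    exact (abs_le.1 (g.norm_coe_le_norm y)).2

theorem norm_inv_pow_smul_pow_le (T : IsTransferOp φ θ C b L) (hlam : 0 < lam)
    (hν : ∀ g : ShiftSpace →ᵇ ℝ, ∫ ω, L g ω ∂(ν : Measure ShiftSpace) =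
    lam * ∫ ω, g ω ∂(ν : Measure ShiftSpace)) (n : ℕ) (g : ShiftSpace →ᵇ ℝ) :
    ‖(lam ^ n)⁻¹ • (L ^ n) g‖ ≤ Real.exp (distortion θ C) * ‖g‖ := by
  refine (BoundedContinuousFunction.norm_le (by positivity)).2 fun x => ?_
  change |(lam ^ n)⁻¹ * (L ^ n) g x| ≤ _
  have h0 : 0 < (lam ^ n)⁻¹ := by positivity
  rw [abs_mul, abs_of_pos h0]
  calc _ ≤ (lam ^ n)⁻¹ * (‖g‖ * (L ^ n) 1 x) :=
        mul_le_mul_of_nonneg_left (T.abs_pow_apply_le n g x) h0.le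
    _ = ((lam ^ n)⁻¹ * (L ^ n) 1 x) * ‖g‖ := by ring
    _ ≤ _ := mul_le_mul_of_nonneg_right (T.inv_pow_mul_pow_one_le hlam hν n x) (norm_nonneg _)

/-- The eigenfunction `h = lim lam ^ (-n) L ^ n 1`. -/
theorem exists_eigenfunction (T : IsTransferOp φ θ C b L) (hlam : 0 < lam)
    (hν : ∀ g : ShiftSpace →ᵇ ℝ, ∫ ω, L g ω ∂(ν : Measure ShiftSpace) =
      lam * ∫ ω, g ω ∂(ν : Measure ShiftSpace))
    (hest : ∀ (D : ℝ) (g : ShiftSpace →ᵇ ℝ), 0 ≤ D → HasModulus θ (modulusConst θ C) D g →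
        ∀ k x, |(L ^ k) g x / (L ^ k) 1 x - ∫ ω, g ω ∂(ν : Measure ShiftSpace)| ≤
          contractionRate θ C ^ k * D) :
    ∃ (h : ShiftSpace →ᵇ ℝ) (A : ℝ), 0 ≤ A ∧
      (∀ n, ‖(lam ^ n)⁻¹ • (L ^ n) 1 - h‖ ≤ A * contractionRate θ C ^ n) ∧
      L h = lam • h ∧ ∫ ω, h ω ∂(ν : Measure ShiftSpace) = 1 ∧
      (∀ x, (Real.exp (distortion θ C))⁻¹ ≤ h x) ∧
      ∀ n x y, AgreeUpTo n x y → h x ≤ Real.exp (distortion θ C * θ ^ n) * h y := by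
  have hκ0 := T.contractionRate_pos
  have hκ1 := T.contractionRate_lt_one
  set κ := contractionRate θ C with hκ
  set K := distortion θ C with hK
  set u : ℕ → ShiftSpace →ᵇ ℝ := fun n => (lam ^ n)⁻¹ • (L ^ n) 1 with hu
  have huapp : ∀ n x, u n x = (lam ^ n)⁻¹ * (L ^ n) 1 x := fun n x => rfl
  have hL1 : ∫ ω, L 1 ω ∂(ν : Measure ShiftSpace) = lam := by
    simpa using integral_pow_one hν 1
  -- With g = L1 the convergence estimate says that L^{n+1} 1 / L^n 1 tends to λ geometrically, so
  -- consecutive terms of λ^{-n} L^n 1 differ by O(κ^n).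
  obtain ⟨D, hD, hmod⟩ : ∃ D, 0 ≤ D ∧ HasModulus θ (modulusConst θ C) D (L 1) := by
    have hpos : ∀ x, 0 ≤ L 1 x := fun x => by simpa using (T.pow_one_pos 1 x).le
    have h1 := sub_le_of_le_exp_mul (f := L 1) (S := ‖L 1‖) T.theta_pos T.theta_lt_one
      T.distortion_pos (fun x => (le_abs_self _).trans ((L 1).norm_coe_le_norm x)) hpos
      (fun n x y hxy => by simpa using T.pow_one_le 1 n x y hxy)
    have hA : 0 ≤ ‖L 1‖ * Real.exp (distortion θ C) * distortion θ C :=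
      mul_nonneg (by positivity) T.distortion_pos.le
    exact ⟨_, div_nonneg hA (mul_nonneg (Real.exp_pos _).le T.modulusConst_pos.le),
      hasModulus_of_le_pow T.theta_pos T.theta_lt_one T.modulusConst_pos hA h1⟩
  have hstep : ∀ n, dist (u n) (u (n + 1)) ≤ (Real.exp K / lam * D) * κ ^ n := by
    intro n
    refine (BoundedContinuousFunction.dist_le (by positivity)).2 fun x => ?_
    have h1 := hest D (L 1) hD hmod n x
    rw [hL1, ← mul_apply_eq_comp, ← pow_succ] at h1
    have h2 := T.pow_one_pos n x
    have h3 : u n x - u (n + 1) x =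
        -(u n x / lam * ((L ^ (n + 1)) 1 x / (L ^ n) 1 x - lam)) := by
      rw [huapp, huapp]
      field_simp
      ring
    have h4 : 0 ≤ u n x / lam := div_nonneg (mul_nonneg (by positivity) h2.le) hlam.le
    rw [Real.dist_eq, h3, abs_neg, abs_mul, abs_of_nonneg h4]
    calc u n x / lam * _ ≤ Real.exp K / lam * (κ ^ n * D) :=
          mul_le_mul (div_le_div_of_nonneg_right (T.inv_pow_mul_pow_one_le hlam hν n x) hlam.le) h1
            (abs_nonneg _) (by positivity)
      _ = _ := by ring
  obtain ⟨h, hh⟩ := cauchySeq_tendsto_of_complete (cauchySeq_of_le_geometric κ _ hκ1 hstep)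
  have hpt : ∀ x, Tendsto (fun n => u n x) atTop (𝓝 (h x)) := fun x =>
    ((BoundedContinuousFunction.tendsto_iff_tendstoUniformly.1 hh).tendsto_at x)
  refine ⟨h, Real.exp K / lam * D / (1 - κ), ?_, fun n => ?_, ?_, ?_, fun x => ?_, ?_⟩
  · exact div_nonneg (by positivity) (by linarith)
  · have := dist_le_of_le_geometric_of_tendsto κ _ hκ1 hstep hh n
    rw [dist_eq_norm] at this
    exact this.trans_eq (by ring)
  · have h1 : Tendsto (fun n => lam • u (n + 1)) atTop (𝓝 (lam • h)) :=
      (hh.comp (tendsto_add_atTop_nat 1)).const_smul lam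
    refine tendsto_nhds_unique ((L.continuous.tendsto h).comp hh) (h1.congr fun n => ?_)
    simp only [hu, Function.comp_apply]
    rw [map_smul, pow_succ' L, mul_apply_eq_comp, smul_smul]
    congr 1
    rw [pow_succ, mul_inv]
    field_simp
  · have h1 : Tendsto (fun n => integralFunctional ν (u n)) atTop
        (𝓝 (integralFunctional ν h)) := ((integralFunctional ν).continuous.tendsto h).comp hh
    refine tendsto_nhds_unique h1 (tendsto_const_nhds.congr fun n => ?_)
    simp only [hu]
    rw [map_smul]
    change 1 = (lam ^ n)⁻¹ * ∫ ω, (L ^ n) 1 ω ∂(ν : Measure ShiftSpace)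
    rw [integral_pow_one hν, inv_mul_cancel₀ (by positivity)]
  · exact ge_of_tendsto (hpt x) (Eventually.of_forall fun n =>
      T.le_inv_pow_mul_pow_one hlam hν n x)
  · intro n x y hxy
    refine le_of_tendsto_of_tendsto' (hpt x) ((hpt y).const_mul _) fun k => ?_
    rw [huapp, huapp, mul_left_comm]
    exact mul_le_mul_of_nonneg_left (T.pow_one_le k n x y hxy) (by positivity)

/-- λ^{-n} L^n g is the product of λ^{-n} L^n 1, which tends to h, and L^n g / L^n 1, which tends to
∫ g dν; both limits are geometric. -/
theorem norm_sub_le_of_hasModulus (T : IsTransferOp φ θ C b L) (hlam : 0 < lam)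
    (hν : ∀ g : ShiftSpace →ᵇ ℝ, ∫ ω, L g ω ∂(ν : Measure ShiftSpace) =
      lam * ∫ ω, g ω ∂(ν : Measure ShiftSpace))
    (hest : ∀ (D : ℝ) (g : ShiftSpace →ᵇ ℝ), 0 ≤ D → HasModulus θ (modulusConst θ C) D g →
        ∀ k x, |(L ^ k) g x / (L ^ k) 1 x - ∫ ω, g ω ∂(ν : Measure ShiftSpace)| ≤
          contractionRate θ C ^ k * D)
    {h : ShiftSpace →ᵇ ℝ} {A : ℝ} (hA : 0 ≤ A)
    (hh : ∀ n, ‖(lam ^ n)⁻¹ • (L ^ n) 1 - h‖ ≤ A * contractionRate θ C ^ n)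
    {D : ℝ} (hD : 0 ≤ D) {g : ShiftSpace →ᵇ ℝ} (hg : HasModulus θ (modulusConst θ C) D g)
    (n : ℕ) :
    ‖(lam ^ n)⁻¹ • (L ^ n) g - (∫ ω, g ω ∂(ν : Measure ShiftSpace)) • h‖ ≤
      (Real.exp (distortion θ C) * D + |∫ ω, g ω ∂(ν : Measure ShiftSpace)| * A) *
        contractionRate θ C ^ n := by
  have hκ0 := T.contractionRate_pos
  set κ := contractionRate θ C with hκ
  set I := ∫ ω, g ω ∂(ν : Measure ShiftSpace) with hI
  refine (BoundedContinuousFunction.norm_le (by positivity)).2 fun x => ?_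
  have h1 := hest D g hD hg n x
  have h2 := ((((lam ^ n)⁻¹ • (L ^ n) 1 - h).norm_coe_le_norm x)).trans (hh n)
  have hu := T.inv_pow_mul_pow_one_le hlam hν n x
  have hpos := T.pow_one_pos n x
  change |(lam ^ n)⁻¹ * (L ^ n) 1 x - h x| ≤ _ at h2
  change |(lam ^ n)⁻¹ * (L ^ n) g x - I * h x| ≤ _
  have h3 : (lam ^ n)⁻¹ * (L ^ n) g x - I * h x =
      ((lam ^ n)⁻¹ * (L ^ n) 1 x) * ((L ^ n) g x / (L ^ n) 1 x - I) +
        I * ((lam ^ n)⁻¹ * (L ^ n) 1 x - h x) := by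
    field_simp
    ring
  have h4 : 0 ≤ (lam ^ n)⁻¹ * (L ^ n) 1 x := by positivity
  rw [h3]
  refine (abs_add_le _ _).trans ?_
  rw [abs_mul ((lam ^ n)⁻¹ * (L ^ n) 1 x), abs_mul I, abs_of_nonneg h4]
  calc _ ≤ Real.exp (distortion θ C) * (κ ^ n * D) + |I| * (A * κ ^ n) :=
        add_le_add (mul_le_mul hu h1 (abs_nonneg _) (Real.exp_pos _).le)
          (mul_le_mul_of_nonneg_left h2 (abs_nonneg _))
    _ = _ := by ring

theorem tendsto_of_uniformContinuous (T : IsTransferOp φ θ C b L) (hlam : 0 < lam)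
    (hν : ∀ g : ShiftSpace →ᵇ ℝ, ∫ ω, L g ω ∂(ν : Measure ShiftSpace) =
      lam * ∫ ω, g ω ∂(ν : Measure ShiftSpace))
    (hest : ∀ (D : ℝ) (g : ShiftSpace →ᵇ ℝ), 0 ≤ D → HasModulus θ (modulusConst θ C) D g →
        ∀ k x, |(L ^ k) g x / (L ^ k) 1 x - ∫ ω, g ω ∂(ν : Measure ShiftSpace)| ≤
          contractionRate θ C ^ k * D)
    {h : ShiftSpace →ᵇ ℝ} {A : ℝ} (hA : 0 ≤ A)
    (hh : ∀ n, ‖(lam ^ n)⁻¹ • (L ^ n) 1 - h‖ ≤ A * contractionRate θ C ^ n)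
    {g : ShiftSpace →ᵇ ℝ} (hg : UniformContinuous g) :
    Tendsto (fun n : ℕ => (lam ^ n)⁻¹ • (L ^ n) g) atTop
      (𝓝 ((∫ ω, g ω ∂(ν : Measure ShiftSpace)) • h)) := by
  have hκ0 := T.contractionRate_pos
  have hκ1 := T.contractionRate_lt_one
  -- Replacing g by a truncation f costs at most (e^K + ‖h‖) ‖g - f‖ at every time n, by the uniform
  -- bound on λ^{-n} L^n.
  set M := Real.exp (distortion θ C) + ‖h‖ + 1 with hM
  have hMpos : 0 < M := by positivity
  rw [Metric.tendsto_atTop]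
  intro ε hε
  obtain ⟨m, hm⟩ := (Metric.tendsto_atTop.1 (tendsto_truncate_of_uniformContinuous hg)
    (ε / (2 * M)) (by positivity))
  have hclose := hm m le_rfl
  rw [dist_comm, dist_eq_norm, lt_div_iff₀ (by positivity)] at hclose
  set f := truncate m g with hf
  obtain ⟨D, hD, hfD⟩ := hasModulus_truncate T.theta_pos T.theta_lt_one T.modulusConst_pos m g
  have hlim : Tendsto (fun n => (Real.exp (distortion θ C) * D +
      |∫ ω, f ω ∂(ν : Measure ShiftSpace)| * A) * contractionRate θ C ^ n) atTop (𝓝 0) := by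
    simpa using (tendsto_pow_atTop_nhds_zero_of_lt_one hκ0.le hκ1).const_mul
      (Real.exp (distortion θ C) * D + |∫ ω, f ω ∂(ν : Measure ShiftSpace)| * A)
  obtain ⟨N, hN⟩ := eventually_atTop.1 (hlim.eventually_lt_const (half_pos hε))
  refine ⟨N, fun n hn => ?_⟩
  have h1 := (T.norm_sub_le_of_hasModulus hlam hν hest hA hh hD hfD n).trans_lt (hN n hn)
  have h2 := T.norm_inv_pow_smul_pow_le hlam hν n (g - f)
  have h3 : |∫ ω, (g - f) ω ∂(ν : Measure ShiftSpace)| ≤ ‖g - f‖ := by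
    simpa using (g - f).norm_integral_le_norm (μ := (ν : Measure ShiftSpace))
  have h4 : ∫ ω, (g - f) ω ∂(ν : Measure ShiftSpace) =
      (∫ ω, g ω ∂(ν : Measure ShiftSpace)) - ∫ ω, f ω ∂(ν : Measure ShiftSpace) :=
    integral_sub (g.integrable _) (f.integrable _)
  have h5 : (lam ^ n)⁻¹ • (L ^ n) g - (∫ ω, g ω ∂(ν : Measure ShiftSpace)) • h =
      (lam ^ n)⁻¹ • (L ^ n) (g - f) +
      ((lam ^ n)⁻¹ • (L ^ n) f - (∫ ω, f ω ∂(ν : Measure ShiftSpace)) • h) -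
      (∫ ω, (g - f) ω ∂(ν : Measure ShiftSpace)) • h := by
    rw [h4, map_sub]
    ext x
    simp only [BoundedContinuousFunction.coe_sub, BoundedContinuousFunction.coe_add,
      BoundedContinuousFunction.coe_smul, Pi.sub_apply, Pi.add_apply, smul_eq_mul]
    ring
  rw [dist_eq_norm, h5]
  refine (norm_sub_le _ _).trans_lt ?_
  have h6 := norm_add_le ((lam ^ n)⁻¹ • (L ^ n) (g - f))
    ((lam ^ n)⁻¹ • (L ^ n) f - (∫ ω, f ω ∂(ν : Measure ShiftSpace)) • h)
  have h7 : ‖(∫ ω, (g - f) ω ∂(ν : Measure ShiftSpace)) • h‖ ≤ ‖g - f‖ * ‖h‖ := by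
    rw [norm_smul]
    exact mul_le_mul_of_nonneg_right h3 (norm_nonneg _)
  nlinarith [norm_nonneg (g - f)]

end Eigenmeasure

end IsTransferOp

end CountableIFS

/-! ### Pressure and periodic points. -/

namespace CountableIFS

theorem iterate_shift_apply (n : ℕ) : ∀ (ω : ShiftSpace) (k : ℕ), shift^[n] ω k = ω (k + n) := by
  induction n with
  | zero => intro ω k; rfl
  | succ n ih =>
    intro ω k
    rw [Function.iterate_succ_apply, ih]
    rfl

theorem prependWord_mem_cylinder {n : ℕ} (w : Fin n → ℕ) (x : ShiftSpace) :
    prependWord w x ∈ cylinder w := by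
  induction n with
  | zero => exact fun k => k.elim0
  | succ n ih =>
    intro k
    refine Fin.cases rfl (fun j => ?_) k
    exact ih (Fin.tail w) j

theorem eq_prependWord_of_mem_cylinder {n : ℕ} {w : Fin n → ℕ} : ∀ {τ : ShiftSpace},
    τ ∈ cylinder w → τ = prependWord w (shift^[n] τ) := by
  induction n with
  | zero => intro τ _; rfl
  | succ n ih =>
    intro τ hτ
    have h1 : shift τ ∈ cylinder (Fin.tail w) := fun k => hτ k.succ
    ext k
    cases k with
    | zero => exact hτ 0
    | succ k => exact congrFun (ih h1) k

/-- The periodic sequence obtained by repeating a word. -/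
def periodicWord {m : ℕ} (w : Fin (m + 1) → ℕ) : ShiftSpace :=
  fun k => w ⟨k % (m + 1), Nat.mod_lt _ (Nat.succ_pos m)⟩

theorem periodicWord_mem_cylinder {m : ℕ} (w : Fin (m + 1) → ℕ) :
    periodicWord w ∈ cylinder w := by
  intro k
  unfold periodicWord
  congr 1
  exact Fin.ext (Nat.mod_eq_of_lt k.2)

theorem iterate_shift_periodicWord {m : ℕ} (w : Fin (m + 1) → ℕ) :
    shift^[m + 1] (periodicWord w) = periodicWord w := by
  ext k
  rw [iterate_shift_apply]
  unfold periodicWord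
  congr 1
  exact Fin.ext (Nat.add_mod_right k (m + 1))

/-- The periodic points of period `m + 1` with first letter `i` correspond to the words of
length `m`. -/
theorem bijective_periodicWord (m i : ℕ) : Function.Bijective
    (fun w : Fin m → ℕ => (⟨periodicWord (Fin.cons i w : Fin (m + 1) → ℕ),
      iterate_shift_periodicWord _, periodicWord_mem_cylinder _ 0⟩ :
      {ω : ShiftSpace // shift^[m + 1] ω = ω ∧ ω 0 = i})) := by
  constructor
  · intro w w' hww
    have h1 := congrArg Subtype.val hww
    ext k
    have h2 := periodicWord_mem_cylinder (Fin.cons i w : Fin (m + 1) → ℕ) k.succ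
    have h3 := periodicWord_mem_cylinder (Fin.cons i w' : Fin (m + 1) → ℕ) k.succ
    rw [Fin.cons_succ] at h2 h3
    rw [← h2, ← h3]
    exact congrFun h1 _
  · rintro ⟨ω, hω, rfl⟩
    refine ⟨fun k => ω (k + 1), Subtype.ext ?_⟩
    ext k
    have hper : Function.Periodic ω (m + 1) := fun k =>
      (iterate_shift_apply (m + 1) ω k).symm.trans (congrFun hω k)
    refine Eq.trans ?_ (hper.map_mod_nat k)
    have h1 : ∀ j : Fin (m + 1), (Fin.cons (ω 0) (fun k : Fin m => ω (k + 1)) :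
        Fin (m + 1) → ℕ) j = ω j := fun j => Fin.cases rfl (fun _ => rfl) j
    exact h1 ⟨k % (m + 1), Nat.mod_lt _ (Nat.succ_pos m)⟩

/-- Two-sided exponential bounds for the partition functions determine the pressure. -/
theorem hasPressure_of_bounds {φ : ShiftSpace → ℝ} {P K : ℝ}
    (h1 : ∀ n : ℕ, ENNReal.ofReal (Real.exp (n * P - K)) ≤ partitionFn φ n)
    (h2 : ∀ n : ℕ, partitionFn φ n ≤ ENNReal.ofReal (Real.exp (n * P + K))) :
    HasPressure φ P := by
  have hlim : ∀ c : ℝ, Tendsto (fun n : ℕ => (((n * P + c) / n : ℝ) : EReal)) atTop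
      (𝓝 (P : EReal)) := by
    intro c
    refine (continuous_coe_real_ereal.tendsto P).comp ?_
    have h3 : Tendsto (fun n : ℕ => P + c / n) atTop (𝓝 (P + 0)) :=
      (tendsto_const_div_atTop_nhds_zero_nat c).const_add P
    rw [add_zero] at h3
    refine h3.congr' ?_
    filter_upwards [eventually_gt_atTop 0] with n hn
    have : (n : ℝ) ≠ 0 := by positivity
    field_simp
  have hn : ∀ n : ℕ, (0 : EReal) ≤ (n : EReal) := fun n => by positivity
  -- This includes n = 0, where both quotients are 0 by convention.
  have hexp : ∀ (c : ℝ) (n : ℕ), ENNReal.log (ENNReal.ofReal (Real.exp (n * P + c))) / (n : EReal)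
      = (((n * P + c) / n : ℝ) : EReal) := by
    intro c n
    rw [ENNReal.log_ofReal_of_pos (Real.exp_pos _), Real.log_exp, EReal.coe_div]
    rfl
  refine tendsto_of_tendsto_of_tendsto_of_le_of_le (hlim (-K)) (hlim K) (fun n => ?_) fun n => ?_
  · rw [← hexp]
    refine EReal.div_le_div_right_of_nonneg (hn n) (ENNReal.log_le_log ?_)
    rw [← sub_eq_add_neg]
    exact h1 n
  · rw [← hexp]
    exact EReal.div_le_div_right_of_nonneg (hn n) (ENNReal.log_le_log (h2 n))

namespace IsTransferOp

variable {φ : ShiftSpace → ℝ} {θ C : ℝ} {b : ℕ → ℝ}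
  {L : (ShiftSpace →ᵇ ℝ) →L[ℝ] (ShiftSpace →ᵇ ℝ)}

theorem birkhoffSum_prependWord_sub_le (T : IsTransferOp φ θ C b L) {n : ℕ} (w : Fin n → ℕ)
    (x y : ShiftSpace) : birkhoffSum shift φ n (prependWord w x) -
      birkhoffSum shift φ n (prependWord w y) ≤ distortion θ C := by
  have hagree : ∀ {n : ℕ} (w : Fin n → ℕ), AgreeUpTo n (prependWord w x) (prependWord w y) :=
    fun w k hk => (prependWord_mem_cylinder w x ⟨k, hk⟩).trans
      (prependWord_mem_cylinder w y ⟨k, hk⟩).symm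
  -- The agreement lengths along the orbit are n, n - 1, …, 1, so the variations form a geometric
  -- series with sum K(1 - θ^n); keeping the factor 1 - θ^n lets the induction close.
  have key : ∀ (n : ℕ) (w : Fin n → ℕ), birkhoffSum shift φ n (prependWord w x) -
      birkhoffSum shift φ n (prependWord w y) ≤ distortion θ C * (1 - θ ^ n) := by
    intro n
    induction n with
    | zero => intro w; simp
    | succ n ih =>
      intro w
      have h1 := T.variation_le n _ _ (hagree w)
      have h2 := ih (Fin.tail w)
      have h3 : ∀ z, birkhoffSum shift φ (n + 1) (prependWord w z) =
          φ (prependWord w z) + birkhoffSum shift φ n (prependWord (Fin.tail w) z) :=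
        fun z => birkhoffSum_prepend _ _ _ _
      have h4 : C * θ ^ (n + 1) = distortion θ C * θ ^ n - distortion θ C * θ ^ (n + 1) := by
        have := T.distortion_mul
        rw [pow_succ]
        linear_combination -(θ ^ n) * this
      rw [h3, h3]
      linarith
  have h0 := mul_pos T.distortion_pos (pow_pos T.theta_pos n)
  linarith [key n w]

theorem tsum_ofReal_exp_birkhoffSum (T : IsTransferOp φ θ C b L) (n : ℕ) (c : ℝ)
    (x : ShiftSpace) : ∑' w : Fin n → ℕ,
      ENNReal.ofReal (Real.exp (c + birkhoffSum shift φ n (prependWord w x))) =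
      ENNReal.ofReal (Real.exp c * (L ^ n) 1 x) := by
  have h1 : HasSum (fun w : Fin n → ℕ =>
      Real.exp (c + birkhoffSum shift φ n (prependWord w x))) (Real.exp c * (L ^ n) 1 x) := by
    refine ((T.hasSum_pow n 1 x).mul_left (Real.exp c)).congr_fun fun w => ?_
    rw [Real.exp_add]
    change _ = _ * (_ * 1)
    rw [mul_one]
  rw [← h1.tsum_eq, ENNReal.ofReal_tsum_of_nonneg (fun _ => (Real.exp_pos _).le) h1.summable]

theorem ofReal_pow_one_le_partitionFn (T : IsTransferOp φ θ C b L) (n : ℕ) (x : ShiftSpace) :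
    ENNReal.ofReal ((L ^ n) 1 x) ≤ partitionFn φ n := by
  have h1 := T.tsum_ofReal_exp_birkhoffSum n 0 x
  simp only [zero_add, Real.exp_zero, one_mul] at h1
  rw [← h1]
  exact ENNReal.tsum_le_tsum fun w =>
    le_iSup₂_of_le (prependWord w x) (prependWord_mem_cylinder w x) le_rfl

/-- Each τ in [w] is w followed by its own tail; exchanging that tail for x costs at most K in the
Birkhoff sum. -/
theorem partitionFn_le (T : IsTransferOp φ θ C b L) (n : ℕ) (x : ShiftSpace) :
    partitionFn φ n ≤ ENNReal.ofReal (Real.exp (distortion θ C) * (L ^ n) 1 x) := by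
  rw [← T.tsum_ofReal_exp_birkhoffSum]
  refine ENNReal.tsum_le_tsum fun w => iSup₂_le fun τ hτ => ?_
  refine ENNReal.ofReal_le_ofReal (Real.exp_le_exp.2 ?_)
  have := T.birkhoffSum_prependWord_sub_le w (shift^[n] τ) x
  rw [← eq_prependWord_of_mem_cylinder hτ] at this
  linarith

/-- The periodic partition function is comparable to the iterates of the transfer operator. -/
theorem periodicPartitionFn_bounds (T : IsTransferOp φ θ C b L) (m i : ℕ) (x : ShiftSpace) :
    ENNReal.ofReal (Real.exp (φ (prepend i x) - (C * θ + distortion θ C)) * (L ^ m) 1 x) ≤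
      periodicPartitionFn φ (m + 1) i ∧
    periodicPartitionFn φ (m + 1) i ≤
      ENNReal.ofReal (Real.exp (φ (prepend i x) + (C * θ + distortion θ C)) * (L ^ m) 1 x) := by
  rw [← T.tsum_ofReal_exp_birkhoffSum, ← T.tsum_ofReal_exp_birkhoffSum, periodicPartitionFn,
    ← (Equiv.ofBijective _ (bijective_periodicWord m i)).tsum_eq]
  -- The periodic point begins with i w. Its first summand is compared with φ(ix) at cost Cθ, the
  -- other m with those along w x at cost K.
  have h1 : ∀ w : Fin m → ℕ, ∃ z, periodicWord (Fin.cons i w : Fin (m + 1) → ℕ) =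
      prepend i (prependWord w z) := fun w =>
    ⟨_, (eq_prependWord_of_mem_cylinder (periodicWord_mem_cylinder _)).trans
      (prependWord_cons _ _ _)⟩
  have h2 : ∀ y z, φ (prepend i y) - φ (prepend i z) ≤ C * θ := fun y z => by
    simpa using T.variation_le 0 _ _ ((agreeUpTo_zero y z).prepend i)
  constructor
  · refine ENNReal.tsum_le_tsum fun w => ENNReal.ofReal_le_ofReal (Real.exp_le_exp.2 ?_)
    obtain ⟨z, hz⟩ := h1 w
    simp only [Equiv.ofBijective_apply]
    rw [hz, birkhoffSum_prepend]
    have h3 := T.birkhoffSum_prependWord_sub_le w x z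
    have h4 := h2 x (prependWord w z)
    linarith
  · refine ENNReal.tsum_le_tsum fun w => ENNReal.ofReal_le_ofReal (Real.exp_le_exp.2 ?_)
    obtain ⟨z, hz⟩ := h1 w
    simp only [Equiv.ofBijective_apply]
    rw [hz, birkhoffSum_prepend]
    have h3 := T.birkhoffSum_prependWord_sub_le w z x
    have h4 := h2 (prependWord w z) x
    linarith

theorem hasPressure (T : IsTransferOp φ θ C b L) {P K : ℝ} {x : ShiftSpace}
    (h1 : ∀ n : ℕ, Real.exp (n * P - K) ≤ (L ^ n) 1 x)
    (h2 : ∀ n : ℕ, (L ^ n) 1 x ≤ Real.exp (n * P + K)) : HasPressure φ P := by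
  have hK := T.distortion_pos
  refine hasPressure_of_bounds (K := K + distortion θ C) (fun n => ?_) fun n => ?_
  · refine le_trans (ENNReal.ofReal_le_ofReal ?_) (T.ofReal_pow_one_le_partitionFn n x)
    exact (Real.exp_le_exp.2 (by linarith)).trans (h1 n)
  · refine (T.partitionFn_le n x).trans (ENNReal.ofReal_le_ofReal ?_)
    rw [add_comm K, add_left_comm, Real.exp_add]
    exact mul_le_mul_of_nonneg_left (h2 n) (Real.exp_pos _).le

theorem positiveRecurrentWith (T : IsTransferOp φ θ C b L) {P K : ℝ} {x : ShiftSpace}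
    (h1 : ∀ n : ℕ, Real.exp (n * P - K) ≤ (L ^ n) 1 x)
    (h2 : ∀ n : ℕ, (L ^ n) 1 x ≤ Real.exp (n * P + K)) :
    PositiveRecurrentWith φ (Real.exp P) := by
  refine ⟨Real.exp_pos _, fun i => ?_⟩
  -- The term |P| pays for comparing L^m 1 with λ^{m+1}: the letter i uses up one unit of the
  -- period.
  set Q := |φ (prepend i x)| + (C * θ + distortion θ C) + K + |P| with hQ
  refine ⟨Real.exp Q, Real.exp_pos _, 1, fun n hn => ?_⟩
  obtain ⟨m, rfl⟩ := Nat.exists_eq_add_of_le' hn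
  obtain ⟨h3, h4⟩ := T.periodicPartitionFn_bounds m i x
  have h5 := abs_le.1 (le_refl |φ (prepend i x)|)
  have h6 := abs_le.1 (le_refl |P|)
  have hpos : 0 < Real.exp P ^ (m + 1) := pow_pos (Real.exp_pos _) _
  have hpow : Real.exp P ^ (m + 1) = Real.exp (m * P + P) := by
    rw [← Real.exp_nat_mul]; push_cast; ring_nf
  have hne : ENNReal.ofReal (Real.exp P ^ (m + 1)) ≠ 0 := (ENNReal.ofReal_pos.2 hpos).ne'
  constructor
  · rw [ENNReal.le_div_iff_mul_le (Or.inl hne) (Or.inl ENNReal.ofReal_ne_top),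
      ← ENNReal.ofReal_mul (by positivity)]
    refine le_trans (ENNReal.ofReal_le_ofReal ?_) h3
    refine le_trans ?_ (mul_le_mul_of_nonneg_left (h1 m) (Real.exp_pos _).le)
    rw [hpow, ← Real.exp_neg, ← Real.exp_add, ← Real.exp_add]
    exact Real.exp_le_exp.2 (by linarith [h5.1, h6.2])
  · rw [ENNReal.div_le_iff hne ENNReal.ofReal_ne_top, ← ENNReal.ofReal_mul (by positivity)]
    refine h4.trans (ENNReal.ofReal_le_ofReal ?_)
    refine (mul_le_mul_of_nonneg_left (h2 m) (Real.exp_pos _).le).trans ?_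
    rw [hpow, ← Real.exp_add, ← Real.exp_add]
    exact Real.exp_le_exp.2 (by linarith [h5.2, h6.1])

end IsTransferOp

end CountableIFS

/-! ### Hölder continuity and the assembly of the theorem. -/

namespace CountableIFS

theorem holderOfOrder_of_bound {β A : ℝ} {f : ShiftSpace → ℝ}
    (h : ∀ n x y, AgreeUpTo n x y → f x - f y ≤ A * Real.exp (-β) ^ n) : HolderOfOrder β f := by
  refine lt_of_le_of_lt (iSup₂_le fun n _ => ?_) (ENNReal.ofReal_lt_top (r := A))
  have h1 : variation f n ≤ ENNReal.ofReal (A * Real.exp (-β) ^ n) := by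
    refine iSup_le fun x => iSup₂_le fun y hxy => ENNReal.ofReal_le_ofReal (abs_le.2 ⟨?_, ?_⟩)
    · linarith [h n y x (AgreeUpTo.symm hxy)]
    · exact h n x y hxy
  refine (mul_le_mul_right h1 _).trans_eq ?_
  rw [← ENNReal.ofReal_mul (Real.exp_pos _).le, mul_left_comm, ← Real.exp_nat_mul,
    ← Real.exp_add]
  congr 1
  rw [mul_comm β, mul_neg, add_neg_cancel, Real.exp_zero, mul_one]

/-- Hölder continuity says nothing about points with different first letters; there boundedness of g
supplies 2‖g‖. -/
theorem HolderOfOrder.exists_hasModulus {β B : ℝ} (hβ : 0 < β) (hB : 0 < B)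
    {g : ShiftSpace →ᵇ ℝ} (hg : HolderOfOrder β g) :
    ∃ D, 0 ≤ D ∧ HasModulus (Real.exp (-β)) B D g := by
  obtain ⟨C, hC, hb⟩ := hg.bound
  have hθ1 : Real.exp (-β) < 1 := Real.exp_lt_one_iff.2 (by linarith)
  have hA : 0 ≤ C + 2 * ‖g‖ := by positivity
  refine ⟨_, div_nonneg hA (mul_nonneg (Real.exp_pos _).le hB.le),
    hasModulus_of_le_pow (Real.exp_pos _) hθ1 hB hA fun n x y hxy => ?_⟩
  cases n with
  | zero =>
    have h1 := (abs_le.1 (g.norm_coe_le_norm x)).2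
    have h2 := (abs_le.1 (g.norm_coe_le_norm y)).1
    rw [pow_zero, mul_one]
    linarith
  | succ n =>
    have h1 := (abs_le.1 (hb (n + 1) (by omega) x y hxy)).2
    have h2 : Real.exp (-(β * (n + 1 : ℕ))) = Real.exp (-β) ^ (n + 1) := by
      rw [← Real.exp_nat_mul]; ring_nf
    rw [h2] at h1
    have : 0 ≤ 2 * ‖g‖ * Real.exp (-β) ^ (n + 1) := by positivity
    linarith

theorem exists_isTransferOp {β : ℝ} {φ : ShiftSpace → ℝ} (hβ : 0 < β)
    (hφ : HolderOfOrder β φ) (hs : FiniteTransfer φ) :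
    ∃ (C : ℝ) (b : ℕ → ℝ), IsTransferOp φ (Real.exp (-β)) C b (transferOp hβ hφ hs) := by
  obtain ⟨C, hC, hb⟩ := hφ.bound
  obtain ⟨b, hbs, hbl⟩ := exists_summable_bound hβ hφ hs
  -- Adding 1 makes the constant strictly positive, as the contraction argument requires.
  refine ⟨C + 1, b, ?_, Real.exp_pos _, Real.exp_lt_one_iff.2 (by linarith), by linarith, ?_, hbs,
    hbl⟩
  · intro g ω
    rw [transferOp_apply]
    refine Summable.hasSum (Summable.of_norm_bounded (hbs.mul_right ‖g‖) fun i => ?_)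
    rw [norm_mul, Real.norm_of_nonneg (Real.exp_pos _).le]
    exact mul_le_mul (hbl i ω) (g.norm_coe_le_norm _) (norm_nonneg _)
      ((Real.exp_pos _).le.trans (hbl i ω))
  · intro n x y hxy
    have h1 := (abs_le.1 (hb (n + 1) (by omega) x y hxy)).2
    have h2 : Real.exp (-(β * (n + 1 : ℕ))) = Real.exp (-β) ^ (n + 1) := by
      rw [← Real.exp_nat_mul]; ring_nf
    rw [h2] at h1
    linarith [pow_pos (Real.exp_pos (-β)) (n + 1)]

end CountableIFS

theorem theorem1p2 {X : Type*} [MetricSpace X] [CompactSpace X] [Nonempty X]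
    (F : UniformIFS X) (ψ : ℕ → C(X, ℝ))
    (hsum : (⨆ x : X, ∑' i : ℕ, ENNReal.ofReal (Real.exp (ψ i x))) < ∞)
    (β : ℝ) (hβ : 0 < β) (hφ : HolderOfOrder β (F.potential ψ))
    (L : (ShiftSpace →ᵇ ℝ) →L[ℝ] (ShiftSpace →ᵇ ℝ))
    (hL : L = transferOp hβ hφ (F.finiteTransfer_potential ψ hsum)) :
    ∃ P lam : ℝ, HasPressure (F.potential ψ) P ∧ lam = Real.exp P ∧
      PositiveRecurrentWith (F.potential ψ) lam ∧
      (∃ M : ℝ, 0 < M ∧ ∀ n : ℕ, 1 ≤ n → ∀ ω : ShiftSpace,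
        M⁻¹ ≤ (lam ^ n)⁻¹ * (L ^ n) 1 ω ∧ (lam ^ n)⁻¹ * (L ^ n) 1 ω ≤ M) ∧
      ((∀ i j : ℕ, i ≠ j → range (F.map i) ∩ range (F.map j) = ∅) →
        ∃ (ν : ProbabilityMeasure ShiftSpace) (h : ShiftSpace →ᵇ ℝ),
          (∃ c : ℝ, 0 < c ∧ ∀ ω, c ≤ h ω) ∧
          HolderOfOrder β h ∧
          conjugateOp L (integralFunctional ν) = lam • integralFunctional ν ∧
          L h = lam • h ∧
          ∫ ω, h ω ∂(ν : Measure ShiftSpace) = 1 ∧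
          (∀ g : ShiftSpace →ᵇ ℝ, UniformContinuous g →
            Tendsto (fun n : ℕ => (lam ^ n)⁻¹ • (L ^ n) g) atTop
              (𝓝 ((∫ ω, g ω ∂(ν : Measure ShiftSpace)) • h))) ∧
          ∃ γ : ℝ, 0 < γ ∧ γ < 1 ∧ ∀ g : ShiftSpace →ᵇ ℝ, HolderOfOrder β g →
            ∃ C : ℝ, ∀ n : ℕ,
              ‖(lam ^ n)⁻¹ • (L ^ n) g - (∫ ω, g ω ∂(ν : Measure ShiftSpace)) • h‖
                ≤ C * γ ^ n) := by
  obtain ⟨C, b, T⟩ := exists_isTransferOp hβ hφ (F.finiteTransfer_potential ψ hsum)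
  rw [← hL] at T
  obtain ⟨ν, lam, hlam, hν, hest⟩ := T.exists_eigenmeasure
  have hlow := T.le_inv_pow_mul_pow_one hlam hν
  have hupp := T.inv_pow_mul_pow_one_le hlam hν
  have hpow : ∀ n : ℕ, lam ^ n = Real.exp (n * Real.log lam) := fun n => by
    rw [Real.exp_nat_mul, Real.exp_log hlam]
  -- The eigenvalue bounds on L^n 1 in exponential form; they identify log λ as the pressure.
  have hb1 : ∀ n : ℕ, Real.exp (n * Real.log lam - distortion (Real.exp (-β)) C) ≤ (L ^ n) 1 0 := by
    intro n
    have := hlow n 0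
    rwa [← div_eq_inv_mul, le_div_iff₀ (pow_pos hlam n), hpow, ← Real.exp_neg, ← Real.exp_add,
      neg_add_eq_sub] at this
  have hb2 : ∀ n : ℕ, (L ^ n) 1 0 ≤ Real.exp (n * Real.log lam + distortion (Real.exp (-β)) C) := by
    intro n
    have := hupp n 0
    rwa [inv_mul_le_iff₀ (pow_pos hlam n), hpow, ← Real.exp_add] at this
  refine ⟨Real.log lam, lam, T.hasPressure hb1 hb2, (Real.exp_log hlam).symm, ?_,
    ⟨_, Real.exp_pos _, fun n _ ω => ⟨hlow n ω, hupp n ω⟩⟩, fun _ => ?_⟩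
  · have := T.positiveRecurrentWith hb1 hb2
    rwa [Real.exp_log hlam] at this
  obtain ⟨h, A, hA, hh, hLh, hint, hhlow, hhdist⟩ := T.exists_eigenfunction hlam hν hest
  have hhpos : ∀ x, 0 ≤ h x := fun x => (inv_pos.2 (Real.exp_pos _)).le.trans (hhlow x)
  refine ⟨ν, h, ⟨_, inv_pos.2 (Real.exp_pos _), hhlow⟩, ?_, ?_, hLh, hint,
    fun g hg => T.tendsto_of_uniformContinuous hlam hν hest hA hh hg,
    contractionRate (Real.exp (-β)) C, T.contractionRate_pos, T.contractionRate_lt_one,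
    fun g hg => ?_⟩
  · exact holderOfOrder_of_bound (sub_le_of_le_exp_mul T.theta_pos T.theta_lt_one T.distortion_pos
      (fun x => (le_abs_self _).trans (h.norm_coe_le_norm x)) hhpos hhdist)
  · ext g
    exact hν g
  · obtain ⟨D, hD, hmod⟩ := hg.exists_hasModulus hβ T.modulusConst_pos
    exact ⟨_, fun n => T.norm_sub_le_of_hasModulus hlam hν hest hA hh hD hmod n⟩
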